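/- Setup. Let $R$ be a commutative ring with $1$, let $*:R\to R$ be a ring automorphism with $r^{**}=r$, let $\sigma$ be an automorphism of $R$ commuting with $*$, and let $t\in R$ with $t^*=t$. Let $A=R(\sigma,t)$ be the generalized Weyl algebra: the ring generated by $R$ (as a subring) and $X,Y$ with relations $YX=t$, $XY=\sigma(t)$, $Xr=\sigma(r)X$, $Yr=\sigma^{-1}(r)Y$ for $r\in R$. It carries the involution (anti-automorphism) extending $*$ with $X^*=Y$, $Y^*=X$, and the $\mathbb Z$-grading $A=\bigoplus_n A_n$ with $\deg X=1$, $\deg Y=-1$, $\deg r=0$. Let $\omega$ be an orbit of $\sigma$ on the set of maximal ideals of $R$, fix $\mathfrak m(\omega)\in\omega$, write $K_{\mathfrak n}=R/\mathfrak n$, $K_\omega=K_{\mathfrak m(\omega)}$, and $R_\omega=\bigoplus_{\mathfrak n\in\omega}K_{\mathfrak n}$, with the additive bijection $\sigma:R_\omega\to R_\omega$ induced by the isomorphisms $K_{\mathfrak n}\to K_{\sigma(\mathfrak n)}$. An $A$-module $V$ is a weight module if it is the direct sum of the $V_{\mathfrak n}=\{v:\mathfrak n v=0\}$, $\mathfrak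 n$ maximal; its support is $\{\mathfrak n:V_{\mathfrak n}\ne0\}$. Let $V$ be a weight module with support in $\omega$. It is pseudo-unitarizable if there is a biadditive map $F:V\times V\to R_\omega$ with $F(rv,w)=rF(v,w)$ for $r\in R$ and $F(av,w)=\sigma^{n}(F(v,a^*w))$ for $n\in\mathbb Z$, $a\in A_n$, which is non-degenerate: for every $v\neq 0$ there are $w_1,w_2$ with $F(w_1,v)\ne0\ne F(v,w_2)$. The finitistic dual $V^\sharp$ is the set of additive maps $\varphi:V\to R_\omega$ with $\varphi(rv)=r^*\varphi(v)$ for $r\in R$ and $\varphi(V_{\mathfrak n})=0$ for all but finitely many $\mathfrak n\in\omega$; it is an $A$-module by $(r\varphi)(v)=\varphi(r^*v)$, $(X\varphi)(v)=\sigma(\varphi(Yv))$, $(Y\varphi)(v)=\sigma^{-1}(\varphi(Xv))$. Assume now that $\omega$ is finite, $p=|\omega|$, real ($\mathfrak n^*=\mathfrak n$ for all $\mathfrak n\in\omega$) and without breaks ($t\notin\mathfrak n$ for all $\mathfrak n\in\omega$). Let $\tau$ be the automorphism of $K_\omega$ induced by $\sigma^p$, let $a\mapsto\overline a$ be the automorphism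 of $K_\omega$ induced by $*$, and let $P=K_\omega[x,x^{-1};\tau]$ be the skew Laurent polynomial ring, $xa=\tau(a)x$. An element $f\in P$ is indecomposable if the left $P$-module $P/Pf$ is nonzero and not the direct sum of two nonzero submodules; $f,g\in P$ are similar if $P/Pf\cong P/Pg$ as left $P$-modules. For $f=\alpha_0+\alpha_1x+\dots+\alpha_dx^d\in P$ with $\alpha_0\neq0\neq\alpha_d$ let $F_f$ be the $d\times d$ companion matrix over $K_\omega$ with ones directly below the diagonal, last column $(-\alpha_0/\alpha_d,\dots,-\alpha_{d-1}/\alpha_d)^T$, and other entries zero, and let $V(\omega,f)=\bigoplus_{\mathfrak n\in\omega}(K_{\mathfrak n})^d$ be the $A$-module with natural $R$-action in which, for $v\in (K_{\mathfrak n})^d$, $Xv=\sigma(tv)$ if $\mathfrak n\ne\mathfrak m(\omega)$ and $Xv=\sigma(F_f\,tv)$ if $\mathfrak n=\mathfrak m(\omega)$, while $Yv=\sigma^{-1}(v)$ if $\sigma^{-1}(\mathfrak n)\neq\mathfrak m(\omega)$ and $Yv=F_f^{-1}\sigma^{-1}(v)$ if $\sigma^{-1}(\mathfrak n)=\mathfrak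 m(\omega)$. Theorem. Let $\omega$ be a finite real orbit without breaks and let $f=\alpha_0+\alpha_1x+\dots+\alpha_dx^d\in P$, $\alpha_0\ne0\ne\alpha_d$, be indecomposable. Put $$\xi=\big(\sigma(t)\sigma^2(t)\cdots\sigma^p(t)\big)\bmod \mathfrak m(\omega),\qquad \{k\}_\xi=\xi\,\tau(\xi)\cdots\tau^{k-1}(\xi),\qquad f^\sharp=\sum_{k=0}^d\{k\}_\xi\,\tau^k(\overline{\alpha_{d-k}})\,x^k .$$ Then $f^\sharp$ is indecomposable and has nonzero coefficients in degrees $0$ and $d$, and $V(\omega,f)^\sharp\cong V(\omega,f^\sharp)$ as $A$-modules. Moreover $V(\omega,f)$ is pseudo-unitarizable if and only if $f$ is similar to $f^\sharp$ in $P$. -/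

import Mathlib

open scoped DirectSum

noncomputable section

namespace GenWeyl

universe u v

/-! ### The base data and the generalized Weyl algebra -/

/-- The data on a commutative ring `R` that define a generalized Weyl algebra `R(σ, t)` with
involution: an automorphism `star` of order `1` or `2`, an automorphism `sigma` commuting with
it, and a selfadjoint element `t`. -/
structure Datum (R : Type u) [CommRing R] where
  /-- the automorphism `σ` -/
  sigma : R ≃+* R
  /-- the automorphism `*` of order one or two -/
  star : R ≃+* R
  /-- the element `t` -/
  t : R
  star_star : ∀ r, star (star r) = r
  sigma_star : ∀ r, sigma (star r) = star (sigma r)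
  star_t : star t = t

/-- Generators of the generalized Weyl algebra: the elements of `R` and two new symbols. -/
inductive Gen (R : Type u) : Type u
  | coe (r : R) : Gen R
  | X : Gen R
  | Y : Gen R

variable {R : Type u} [CommRing R]

/-- The defining relations: `R` is a subring, `YX = t`, `XY = σ(t)`, `Xr = σ(r)X`,
`Yr = σ⁻¹(r)Y`. -/
inductive Rel (D : Datum R) : FreeAlgebra ℤ (Gen R) → FreeAlgebra ℤ (Gen R) → Prop
  | one : Rel D (FreeAlgebra.ι ℤ (Gen.coe 1)) 1
  | add (r s : R) : Rel D (FreeAlgebra.ι ℤ (Gen.coe (r + s)))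
      (FreeAlgebra.ι ℤ (Gen.coe r) + FreeAlgebra.ι ℤ (Gen.coe s))
  | mul (r s : R) : Rel D (FreeAlgebra.ι ℤ (Gen.coe (r * s)))
      (FreeAlgebra.ι ℤ (Gen.coe r) * FreeAlgebra.ι ℤ (Gen.coe s))
  | yx : Rel D (FreeAlgebra.ι ℤ Gen.Y * FreeAlgebra.ι ℤ Gen.X)
      (FreeAlgebra.ι ℤ (Gen.coe D.t))
  | xy : Rel D (FreeAlgebra.ι ℤ Gen.X * FreeAlgebra.ι ℤ Gen.Y)
      (FreeAlgebra.ι ℤ (Gen.coe (D.sigma D.t)))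
  | xr (r : R) : Rel D (FreeAlgebra.ι ℤ Gen.X * FreeAlgebra.ι ℤ (Gen.coe r))
      (FreeAlgebra.ι ℤ (Gen.coe (D.sigma r)) * FreeAlgebra.ι ℤ Gen.X)
  | yr (r : R) : Rel D (FreeAlgebra.ι ℤ Gen.Y * FreeAlgebra.ι ℤ (Gen.coe r))
      (FreeAlgebra.ι ℤ (Gen.coe (D.sigma.symm r)) * FreeAlgebra.ι ℤ Gen.Y)

/-- The generalized Weyl algebra `A = R(σ, t)`. -/
def Alg (D : Datum R) : Type u := RingQuot (Rel D)

instance (D : Datum R) : Ring (Alg D) := inferInstanceAs (Ring (RingQuot (Rel D)))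

/-- The quotient map from the free ring. -/
def Alg.mk (D : Datum R) : FreeAlgebra ℤ (Gen R) →+* Alg D := RingQuot.mkRingHom (Rel D)

/-- The inclusion `R → A`. -/
def Alg.ofR (D : Datum R) : R →+* Alg D where
  toFun r := Alg.mk D (FreeAlgebra.ι ℤ (Gen.coe r))
  map_one' := by
    rw [← map_one (Alg.mk D)]
    exact RingQuot.mkRingHom_rel Rel.one
  map_zero' := by
    have h : Alg.mk D (FreeAlgebra.ι ℤ (Gen.coe (0 + 0))) = _ :=
      RingQuot.mkRingHom_rel (Rel.add (D := D) 0 0)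
    have h' : Alg.mk D (FreeAlgebra.ι ℤ (Gen.coe (0 + 0)))
        = Alg.mk D (FreeAlgebra.ι ℤ (Gen.coe 0)) + Alg.mk D (FreeAlgebra.ι ℤ (Gen.coe 0)) := by
      rw [← map_add]; exact h
    rw [add_zero] at h'
    exact left_eq_add.mp h'
  map_mul' r s := by
    rw [← map_mul]
    exact RingQuot.mkRingHom_rel (Rel.mul r s)
  map_add' r s := by
    rw [← map_add]
    exact RingQuot.mkRingHom_rel (Rel.add r s)

/-- The generator `X` of `A`. -/
def Alg.X (D : Datum R) : Alg D := Alg.mk D (FreeAlgebra.ι ℤ Gen.X)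

/-- The generator `Y` of `A`. -/
def Alg.Y (D : Datum R) : Alg D := Alg.mk D (FreeAlgebra.ι ℤ Gen.Y)

theorem Alg.Y_mul_X (D : Datum R) : Alg.Y D * Alg.X D = Alg.ofR D D.t :=
  ((Alg.mk D).map_mul _ _).symm.trans (RingQuot.mkRingHom_rel Rel.yx)

theorem Alg.X_mul_Y (D : Datum R) : Alg.X D * Alg.Y D = Alg.ofR D (D.sigma D.t) :=
  ((Alg.mk D).map_mul _ _).symm.trans (RingQuot.mkRingHom_rel Rel.xy)

theorem Alg.X_mul_ofR (D : Datum R) (r : R) :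
    Alg.X D * Alg.ofR D r = Alg.ofR D (D.sigma r) * Alg.X D :=
  ((Alg.mk D).map_mul _ _).symm.trans
    ((RingQuot.mkRingHom_rel (Rel.xr r)).trans ((Alg.mk D).map_mul _ _))

theorem Alg.Y_mul_ofR (D : Datum R) (r : R) :
    Alg.Y D * Alg.ofR D r = Alg.ofR D (D.sigma.symm r) * Alg.Y D :=
  ((Alg.mk D).map_mul _ _).symm.trans
    ((RingQuot.mkRingHom_rel (Rel.yr r)).trans ((Alg.mk D).map_mul _ _))

/-- The images of the generators under a prospective ring homomorphism out of `A`. -/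
def Alg.liftGen {S : Type v} (f : R → S) (x y : S) : Gen R → S
  | Gen.coe r => f r
  | Gen.X => x
  | Gen.Y => y

/-- The universal property of `A`. -/
def Alg.lift (D : Datum R) {S : Type v} [Ring S] (f : R →+* S) (x y : S)
    (hyx : y * x = f D.t) (hxy : x * y = f (D.sigma D.t))
    (hx : ∀ r, x * f r = f (D.sigma r) * x) (hy : ∀ r, y * f r = f (D.sigma.symm r) * y) :
    Alg D →+* S :=
  RingQuot.lift ⟨(FreeAlgebra.lift ℤ (Alg.liftGen f x y) : FreeAlgebra ℤ (Gen R) →+* S), by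
    intro a b h
    cases h <;> simp [Alg.liftGen, hyx, hxy, hx, hy]⟩

section lift

variable (D : Datum R) {S : Type v} [Ring S] (f : R →+* S) (x y : S)
    (hyx : y * x = f D.t) (hxy : x * y = f (D.sigma D.t))
    (hx : ∀ r, x * f r = f (D.sigma r) * x) (hy : ∀ r, y * f r = f (D.sigma.symm r) * y)

theorem Alg.lift_ofR (r : R) : Alg.lift D f x y hyx hxy hx hy (Alg.ofR D r) = f r := by
  refine (RingQuot.lift_mkRingHom_apply _ _ _ ).trans ?_
  simp [Alg.liftGen]

theorem Alg.lift_X : Alg.lift D f x y hyx hxy hx hy (Alg.X D) = x := by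
  refine (RingQuot.lift_mkRingHom_apply _ _ _ ).trans ?_
  simp [Alg.liftGen]

theorem Alg.lift_Y : Alg.lift D f x y hyx hxy hx hy (Alg.Y D) = y := by
  refine (RingQuot.lift_mkRingHom_apply _ _ _ ).trans ?_
  simp [Alg.liftGen]

end lift

/-- The involution of `A` extending `*` on `R`, with `X* = Y` and `Y* = X`, as a ring
homomorphism to the opposite ring. -/
def Alg.starHom (D : Datum R) : Alg D →+* (Alg D)ᵐᵒᵖ :=
  Alg.lift D
    ((Alg.ofR D).toOpposite (fun r s => by
      change Alg.ofR D r * Alg.ofR D s = Alg.ofR D s * Alg.ofR D r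
      rw [← map_mul, ← map_mul, mul_comm]) |>.comp (D.star : R →+* R))
    (MulOpposite.op (Alg.Y D)) (MulOpposite.op (Alg.X D))
    (by
      rw [← MulOpposite.op_mul, Alg.Y_mul_X]
      simp [D.star_t])
    (by
      rw [← MulOpposite.op_mul, Alg.X_mul_Y]
      simp [← D.sigma_star, D.star_t])
    (fun r => by
      simp only [RingHom.comp_apply, RingHom.toOpposite_apply, Function.comp, RingHom.coe_coe]
      rw [← MulOpposite.op_mul, ← MulOpposite.op_mul, Alg.Y_mul_ofR, ← D.sigma_star,
        RingEquiv.symm_apply_apply])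
    (fun r => by
      simp only [RingHom.comp_apply, RingHom.toOpposite_apply, Function.comp, RingHom.coe_coe]
      rw [← MulOpposite.op_mul, ← MulOpposite.op_mul, Alg.X_mul_ofR, D.sigma_star,
        RingEquiv.apply_symm_apply])

/-- The element `a*` of `A`. -/
def Alg.adj (D : Datum R) (a : Alg D) : Alg D := (Alg.starHom D a).unop

/-- `IsHomog D n a` says that `a` lies in the graded piece `A_n` of the `ℤ`-grading of `A` with
`deg X = 1`, `deg Y = -1` and `deg r = 0` for `r ∈ R`. -/
inductive IsHomog (D : Datum R) : ℤ → Alg D → Prop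
  | ofR (r : R) : IsHomog D 0 (Alg.ofR D r)
  | X : IsHomog D 1 (Alg.X D)
  | Y : IsHomog D (-1) (Alg.Y D)
  | zero (n : ℤ) : IsHomog D n 0
  | add {n : ℤ} {a b : Alg D} : IsHomog D n a → IsHomog D n b → IsHomog D n (a + b)
  | mul {m n : ℤ} {a b : Alg D} : IsHomog D m a → IsHomog D n b → IsHomog D (m + n) (a * b)

/-! ### Orbits of maximal ideals -/

/-- The residue field `K_𝔪 = R/𝔪`. -/
abbrev K (m : MaximalSpectrum R) : Type u := R ⧸ m.asIdeal

instance (m : MaximalSpectrum R) : Field (K m) := Ideal.Quotient.field m.asIdeal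

/-- The action of a ring automorphism on maximal ideals, `𝔪 ↦ e(𝔪)`; the image of `𝔪` under `e`
is written as its preimage under `e⁻¹`. -/
def maxPerm (e : R ≃+* R) : Equiv.Perm (MaximalSpectrum R) where
  toFun m := ⟨m.asIdeal.comap (e.symm : R →+* R), Ideal.comap_isMaximal_of_equiv e.symm⟩
  invFun m := ⟨m.asIdeal.comap (e : R →+* R), Ideal.comap_isMaximal_of_equiv e⟩
  left_inv m := by
    ext r
    change e.symm (e r) ∈ m.asIdeal ↔ r ∈ m.asIdeal
    rw [RingEquiv.symm_apply_apply]
  right_inv m := by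
    ext r
    change e (e.symm r) ∈ m.asIdeal ↔ r ∈ m.asIdeal
    rw [RingEquiv.apply_symm_apply]

theorem mem_maxPerm {e : R ≃+* R} {m : MaximalSpectrum R} {r : R} :
    r ∈ (maxPerm e m).asIdeal ↔ e.symm r ∈ m.asIdeal := Iff.rfl

/-- The orbit of `𝔪` under the action of `σ` on maximal ideals. -/
def orbit (D : Datum R) (m : MaximalSpectrum R) : Set (MaximalSpectrum R) :=
  MulAction.orbit (Subgroup.zpowers (maxPerm D.sigma)) m

/-- The chosen ideal `𝔪(ω)` as an element of its orbit `ω`. -/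
def base (D : Datum R) (m : MaximalSpectrum R) : orbit D m :=
  ⟨m, MulAction.mem_orbit_self (M := Subgroup.zpowers (maxPerm D.sigma)) m⟩

theorem maxPerm_mem_orbit (D : Datum R) (m : MaximalSpectrum R) {n : MaximalSpectrum R} :
    maxPerm D.sigma n ∈ orbit D m ↔ n ∈ orbit D m := by
  have h : n ∈ MulAction.orbit (Subgroup.zpowers (maxPerm D.sigma)) (maxPerm D.sigma n) :=
    MulAction.orbit_eq_iff.mp (MulAction.orbit_smul
      (⟨maxPerm D.sigma, Subgroup.mem_zpowers _⟩ : Subgroup.zpowers (maxPerm D.sigma)) n).symm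
  rw [orbit, ← MulAction.orbit_eq_iff, ← MulAction.orbit_eq_iff, ← MulAction.orbit_eq_iff.mpr h]

/-- The permutation of the orbit induced by `σ`. -/
def shift (D : Datum R) (m : MaximalSpectrum R) : Equiv.Perm (orbit D m) :=
  (maxPerm D.sigma).subtypePerm fun _ => maxPerm_mem_orbit D m

/-- An orbit is real if `𝔫* = 𝔫` for each of its members. -/
def IsReal (D : Datum R) (m : MaximalSpectrum R) : Prop :=
  ∀ n ∈ orbit D m, maxPerm D.star n = n

/-- An orbit is without breaks if `t ∉ 𝔫` for each of its members. -/
def NoBreaks (D : Datum R) (m : MaximalSpectrum R) : Prop :=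
  ∀ n ∈ orbit D m, D.t ∉ n.asIdeal

/-- The homomorphism `R/𝔫 → R/e(𝔫)` induced by an automorphism `e` of `R`. -/
def up (e : R ≃+* R) {n n' : MaximalSpectrum R} (h : maxPerm e n = n') : K n →+* K n' :=
  Ideal.quotientMap n'.asIdeal (e : R →+* R) (by
    subst h; intro r hr
    simpa [Ideal.mem_comap, mem_maxPerm] using hr)

/-- The inverse homomorphism `R/e(𝔫) → R/𝔫`, induced by `e⁻¹`. -/
def down (e : R ≃+* R) {n n' : MaximalSpectrum R} (h : maxPerm e n = n') : K n' →+* K n :=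
  Ideal.quotientMap n.asIdeal (e.symm : R →+* R) (by
    subst h; intro r hr
    simpa [Ideal.mem_comap, mem_maxPerm] using hr)

theorem down_up (e : R ≃+* R) {n n' : MaximalSpectrum R} (h : maxPerm e n = n') (a : K n) :
    down e h (up e h a) = a := by
  obtain ⟨r, rfl⟩ := Ideal.Quotient.mk_surjective a
  simp [up, down]

theorem up_down (e : R ≃+* R) {n n' : MaximalSpectrum R} (h : maxPerm e n = n') (a : K n') :
    up e h (down e h a) = a := by
  obtain ⟨r, rfl⟩ := Ideal.Quotient.mk_surjective a
  simp [up, down]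

theorem shift_spec (D : Datum R) (m : MaximalSpectrum R) (n : orbit D m) :
    maxPerm D.sigma n.1 = (shift D m n).1 := rfl

theorem shift_symm_spec (D : Datum R) (m : MaximalSpectrum R) (n : orbit D m) :
    maxPerm D.sigma ((shift D m).symm n).1 = n.1 :=
  congrArg Subtype.val ((shift D m).apply_symm_apply n)

/-- The `R`-module `R_ω`, the direct sum of the `R/𝔫` for `𝔫 ∈ ω`. -/
abbrev Rom (D : Datum R) (m : MaximalSpectrum R) : Type u := ⨁ n : orbit D m, K n.1

open Classical in
/-- The inclusion of `R/𝔫` into `R_ω`. -/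
def Rom.of (D : Datum R) (m : MaximalSpectrum R) (n : orbit D m) : K n.1 →+ Rom D m :=
  DirectSum.of (fun n : orbit D m => K n.1) n

open Classical in
/-- The map `R_ω → R_ω` with `σ : R/𝔫 → R/σ(𝔫)` on each summand. -/
def sigmaFwd (D : Datum R) (m : MaximalSpectrum R) : Rom D m →+ Rom D m :=
  DirectSum.toAddMonoid fun n => (Rom.of D m (shift D m n)).comp
    (up D.sigma (shift_spec D m n)).toAddMonoidHom

open Classical in
/-- The map `R_ω → R_ω` with `σ⁻¹ : R/𝔫 → R/σ⁻¹(𝔫)` on each summand. -/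
def sigmaBwd (D : Datum R) (m : MaximalSpectrum R) : Rom D m →+ Rom D m :=
  DirectSum.toAddMonoid fun n => (Rom.of D m ((shift D m).symm n)).comp
    (down D.sigma (shift_symm_spec D m n)).toAddMonoidHom

theorem sigmaFwd_of (D : Datum R) (m : MaximalSpectrum R) (n : orbit D m) (a : K n.1) :
    sigmaFwd D m (Rom.of D m n a) = Rom.of D m (shift D m n) (up D.sigma (shift_spec D m n) a) := by
  classical
  exact DirectSum.toAddMonoid_of _ _ _

theorem sigmaBwd_of (D : Datum R) (m : MaximalSpectrum R) (n : orbit D m) (a : K n.1) :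
    sigmaBwd D m (Rom.of D m n a)
      = Rom.of D m ((shift D m).symm n) (down D.sigma (shift_symm_spec D m n) a) := by
  classical
  exact DirectSum.toAddMonoid_of _ _ _

theorem Rom.induction {D : Datum R} {m : MaximalSpectrum R} {p : Rom D m → Prop} (a : Rom D m)
    (h0 : p 0) (hof : ∀ n a, p (Rom.of D m n a)) (hadd : ∀ a b, p a → p b → p (a + b)) : p a := by
  classical
  exact DirectSum.induction_on a h0 hof hadd

theorem sigmaBwd_sigmaFwd (D : Datum R) (m : MaximalSpectrum R) (a : Rom D m) :
    sigmaBwd D m (sigmaFwd D m a) = a := by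
  have key : ∀ (n n1 : orbit D m) (n' : MaximalSpectrum R) (_ : n1 = n)
      (h : maxPerm D.sigma n1.1 = n') (h0 : maxPerm D.sigma n.1 = n') (a : K n.1),
      Rom.of D m n1 (down D.sigma h (up D.sigma h0 a)) = Rom.of D m n a := by
    rintro n _ n' rfl h h0 a
    rw [down_up]
  induction a using Rom.induction with
  | h0 => simp
  | hof n a =>
    rw [sigmaFwd_of, sigmaBwd_of]
    exact key _ _ _ (Equiv.symm_apply_apply _ _) _ _ _
  | hadd a b ha hb => rw [map_add, map_add, ha, hb]

theorem sigmaFwd_sigmaBwd (D : Datum R) (m : MaximalSpectrum R) (a : Rom D m) :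
    sigmaFwd D m (sigmaBwd D m a) = a := by
  have key : ∀ (n n1 : orbit D m) (n0 : MaximalSpectrum R) (_ : n1 = n)
      (h : maxPerm D.sigma n0 = n1.1) (h0 : maxPerm D.sigma n0 = n.1) (a : K n.1),
      Rom.of D m n1 (up D.sigma h (down D.sigma h0 a)) = Rom.of D m n a := by
    rintro n _ n' rfl h h0 a
    rw [up_down]
  induction a using Rom.induction with
  | h0 => simp
  | hof n a =>
    rw [sigmaBwd_of, sigmaFwd_of]
    exact key _ _ _ (Equiv.apply_symm_apply _ _) _ _ _
  | hadd a b ha hb => rw [map_add, map_add, ha, hb]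

/-- The bijection `σ : R_ω → R_ω`, the additive extension of the maps `R/𝔫 → R/σ(𝔫)`. -/
def sigmaOm (D : Datum R) (m : MaximalSpectrum R) : Equiv.Perm (Rom D m) where
  toFun := sigmaFwd D m
  invFun := sigmaBwd D m
  left_inv := sigmaBwd_sigmaFwd D m
  right_inv := sigmaFwd_sigmaBwd D m

theorem sigmaFwd_smul (D : Datum R) (m : MaximalSpectrum R) (r : R) (a : Rom D m) :
    sigmaFwd D m (r • a) = D.sigma r • sigmaFwd D m a := by
  induction a using Rom.induction with
  | h0 => simp
  | hof n a =>
    obtain ⟨s, rfl⟩ := Ideal.Quotient.mk_surjective a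
    have hs : ∀ (n : orbit D m) (r : R) (a : K n.1),
        r • Rom.of D m n a = Rom.of D m n (r • a) := fun n r a => by
      classical
      exact (DirectSum.of_smul R (M := fun n : orbit D m => K n.1) n r a).symm
    have h1 : ∀ (n : orbit D m) (r s : R),
        r • (Ideal.Quotient.mk n.1.asIdeal s) = Ideal.Quotient.mk n.1.asIdeal (r * s) :=
      fun n r s => rfl
    rw [hs, h1, sigmaFwd_of, sigmaFwd_of, hs]
    simp only [up, Ideal.quotientMap_mk, h1, RingHom.coe_coe, map_mul]
  | hadd a b ha hb => rw [smul_add, map_add, map_add, ha, hb, smul_add]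

theorem sigmaBwd_smul (D : Datum R) (m : MaximalSpectrum R) (r : R) (a : Rom D m) :
    sigmaBwd D m (r • a) = D.sigma.symm r • sigmaBwd D m a := by
  apply (sigmaOm D m).injective
  change sigmaFwd D m _ = sigmaFwd D m _
  rw [sigmaFwd_sigmaBwd, sigmaFwd_smul, sigmaFwd_sigmaBwd, RingEquiv.apply_symm_apply]

/-! ### Weight modules, admissible forms, the finitistic dual -/

section modules

variable (D : Datum R) (V : Type v) [AddCommGroup V] [Module (Alg D) V]

/-- The weight space `V_𝔫 = {v | 𝔫 v = 0}`. -/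
def weightSpace (n : MaximalSpectrum R) : AddSubgroup V where
  carrier := {v | ∀ r ∈ n.asIdeal, Alg.ofR D r • v = 0}
  zero_mem' _ _ := smul_zero _
  add_mem' ha hb r hr := by rw [smul_add, ha r hr, hb r hr, add_zero]
  neg_mem' ha r hr := by rw [smul_neg, ha r hr, neg_zero]

open Classical in
/-- `V` is a weight module: it is the direct sum of its weight spaces. -/
def IsWeightModule : Prop :=
  DirectSum.IsInternal fun n : MaximalSpectrum R => weightSpace D V n

/-- The support of `V`: the set of `𝔫` with `V_𝔫 ≠ 0`. -/
def support : Set (MaximalSpectrum R) := {n | weightSpace D V n ≠ ⊥}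

variable {V}

/-- Admissible forms on `V` with values in `R_ω` (additivity in each argument is part of the
type of `F`). -/
structure IsAdmissible (m : MaximalSpectrum R) (F : V →+ V →+ Rom D m) : Prop where
  smul_left : ∀ (r : R) (v w : V), F (Alg.ofR D r • v) w = r • F v w
  adjoint : ∀ (n : ℤ) (a : Alg D), IsHomog D n a → ∀ v w : V,
    F (a • v) w = (sigmaOm D m ^ n) (F v (Alg.adj D a • w))

/-- Non-degenerate forms. -/
def IsNondegenerate {m : MaximalSpectrum R} (F : V →+ V →+ Rom D m) : Prop :=
  ∀ v : V, v ≠ 0 → ∃ w₁ w₂ : V, F w₁ v ≠ 0 ∧ F v w₂ ≠ 0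

variable (V)

/-- `V` is a weight module with support in the orbit `ω` of `𝔪` which is pseudo-unitarizable:
there is a non-degenerate admissible form on it. -/
def IsPseudoUnitarizable (m : MaximalSpectrum R) : Prop :=
  IsWeightModule D V ∧ support D V ⊆ orbit D m ∧
    ∃ F : V →+ V →+ Rom D m, IsAdmissible D m F ∧ IsNondegenerate D F

/-- The finitistic dual of `V` as an additive group: additive maps `φ : V → R_ω` with
`φ(rv) = r* φ(v)` that vanish on `V_𝔫` for all but finitely many `𝔫 ∈ ω`. -/
def dualSubgroup (m : MaximalSpectrum R) : AddSubgroup (V →+ Rom D m) where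
  carrier := {φ | (∀ (r : R) (v : V), φ (Alg.ofR D r • v) = D.star r • φ v) ∧
    {n : orbit D m | ∃ v ∈ weightSpace D V n.1, φ v ≠ 0}.Finite}
  zero_mem' := ⟨fun _ _ => by simp, by simp⟩
  add_mem' := by
    rintro φ ψ ⟨h1, h2⟩ ⟨h3, h4⟩
    refine ⟨fun r v => by simp [h1, h3], (h2.union h4).subset ?_⟩
    rintro n ⟨v, hv, h⟩
    by_contra hc
    simp only [Set.mem_union, Set.mem_ofPred_eq, not_or, not_exists, not_and, not_not] at hc
    exact h (by simp [hc.1 v hv, hc.2 v hv])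
  neg_mem' := by
    rintro φ ⟨h1, h2⟩
    exact ⟨fun r v => by simp [h1], h2.subset (by rintro n ⟨v, hv, h⟩; exact ⟨v, hv, by simpa using h⟩)⟩

/-- The finitistic dual `V^♯`. -/
def Dual (m : MaximalSpectrum R) : Type (max u v) := dualSubgroup D V m

instance (m : MaximalSpectrum R) : AddCommGroup (Dual D V m) :=
  inferInstanceAs (AddCommGroup (dualSubgroup D V m))

variable {V}

theorem X_smul_mem {n n' : MaximalSpectrum R} (h : maxPerm D.sigma n = n') {v : V}
    (hv : v ∈ weightSpace D V n) : Alg.X D • v ∈ weightSpace D V n' := by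
  subst h
  intro r hr
  have h1 := Alg.X_mul_ofR D (D.sigma.symm r)
  rw [RingEquiv.apply_symm_apply] at h1
  rw [← mul_smul, ← h1, mul_smul, hv (D.sigma.symm r) hr, smul_zero]

theorem Y_smul_mem {n n' : MaximalSpectrum R} (h : maxPerm D.sigma n = n') {v : V}
    (hv : v ∈ weightSpace D V n') : Alg.Y D • v ∈ weightSpace D V n := by
  subst h
  intro r hr
  have h1 := Alg.Y_mul_ofR D (D.sigma r)
  rw [RingEquiv.symm_apply_apply] at h1
  rw [← mul_smul, ← h1, mul_smul, hv _ (by simpa [mem_maxPerm] using hr), smul_zero]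

variable (V) (m : MaximalSpectrum R)

/-- The action of `R` on the dual, `(rφ)(v) = φ(r* v)`. -/
def dualR : R →+* AddMonoid.End (Dual D V m) where
  toFun r :=
    { toFun := fun φ => ⟨φ.1.comp (DistribSMul.toAddMonoidHom V (Alg.ofR D (D.star r))),
        fun s v => by
          change φ.1 (Alg.ofR D (D.star r) • Alg.ofR D s • v)
            = D.star s • φ.1 (Alg.ofR D (D.star r) • v)
          rw [← mul_smul, ← map_mul, mul_comm, map_mul, mul_smul, φ.2.1],
        φ.2.2.subset (by
          rintro n ⟨v, hv, h⟩
          refine ⟨v, hv, fun h0 => h ?_⟩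
          change φ.1 (Alg.ofR D (D.star r) • v) = 0
          rw [φ.2.1, h0, smul_zero])⟩
      map_zero' := rfl
      map_add' := fun _ _ => rfl }
  map_one' := by
    refine AddMonoidHom.ext fun φ => Subtype.ext (AddMonoidHom.ext fun v => ?_)
    change φ.1 (Alg.ofR D (D.star 1) • v) = φ.1 v
    simp
  map_zero' := by
    refine AddMonoidHom.ext fun φ => Subtype.ext (AddMonoidHom.ext fun v => ?_)
    change φ.1 (Alg.ofR D (D.star 0) • v) = 0
    simp
  map_mul' r s := by
    refine AddMonoidHom.ext fun φ => Subtype.ext (AddMonoidHom.ext fun v => ?_)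
    change φ.1 (Alg.ofR D (D.star (r * s)) • v)
      = φ.1 (Alg.ofR D (D.star s) • Alg.ofR D (D.star r) • v)
    rw [← mul_smul, ← map_mul, ← map_mul, mul_comm]
  map_add' r s := by
    refine AddMonoidHom.ext fun φ => Subtype.ext (AddMonoidHom.ext fun v => ?_)
    change φ.1 (Alg.ofR D (D.star (r + s)) • v)
      = φ.1 (Alg.ofR D (D.star r) • v) + φ.1 (Alg.ofR D (D.star s) • v)
    rw [map_add, map_add, add_smul, map_add]

/-- The action of `X` on the dual, `(Xφ)(v) = σ(φ(Yv))`. -/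
def dualX : AddMonoid.End (Dual D V m) where
  toFun φ := ⟨(sigmaFwd D m).comp (φ.1.comp (DistribSMul.toAddMonoidHom V (Alg.Y D))),
    fun r v => by
      change sigmaFwd D m (φ.1 (Alg.Y D • Alg.ofR D r • v))
        = D.star r • sigmaFwd D m (φ.1 (Alg.Y D • v))
      rw [← mul_smul, Alg.Y_mul_ofR, mul_smul, φ.2.1, sigmaFwd_smul, D.sigma_star,
        RingEquiv.apply_symm_apply],
    (φ.2.2.image (shift D m)).subset (by
      rintro n ⟨v, hv, h⟩
      refine ⟨(shift D m).symm n, ⟨Alg.Y D • v, Y_smul_mem D (shift_symm_spec D m n) hv,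
        fun h0 => h ?_⟩, (shift D m).apply_symm_apply n⟩
      change sigmaFwd D m (φ.1 (Alg.Y D • v)) = 0
      rw [h0, map_zero])⟩
  map_zero' := Subtype.ext (AddMonoidHom.ext fun _ => map_zero (sigmaFwd D m))
  map_add' _ _ := Subtype.ext (AddMonoidHom.ext fun _ => map_add (sigmaFwd D m) _ _)

/-- The action of `Y` on the dual, `(Yφ)(v) = σ⁻¹(φ(Xv))`. -/
def dualY : AddMonoid.End (Dual D V m) where
  toFun φ := ⟨(sigmaBwd D m).comp (φ.1.comp (DistribSMul.toAddMonoidHom V (Alg.X D))),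
    fun r v => by
      change sigmaBwd D m (φ.1 (Alg.X D • Alg.ofR D r • v))
        = D.star r • sigmaBwd D m (φ.1 (Alg.X D • v))
      rw [← mul_smul, Alg.X_mul_ofR, mul_smul, φ.2.1, sigmaBwd_smul, ← D.sigma_star,
        RingEquiv.symm_apply_apply],
    (φ.2.2.image (shift D m).symm).subset (by
      rintro n ⟨v, hv, h⟩
      refine ⟨shift D m n, ⟨Alg.X D • v, X_smul_mem D rfl hv,
        fun h0 => h ?_⟩, (shift D m).symm_apply_apply n⟩
      change sigmaBwd D m (φ.1 (Alg.X D • v)) = 0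
      rw [h0, map_zero])⟩
  map_zero' := Subtype.ext (AddMonoidHom.ext fun _ => map_zero (sigmaBwd D m))
  map_add' _ _ := Subtype.ext (AddMonoidHom.ext fun _ => map_add (sigmaBwd D m) _ _)

/-- The action of `A` on the finitistic dual. -/
def dualAction : Alg D →+* AddMonoid.End (Dual D V m) :=
  Alg.lift D (dualR D V m) (dualX D V m) (dualY D V m)
    (by
      refine AddMonoidHom.ext fun φ => Subtype.ext (AddMonoidHom.ext fun v => ?_)
      change sigmaBwd D m (sigmaFwd D m (φ.1 (Alg.Y D • Alg.X D • v)))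
        = φ.1 (Alg.ofR D (D.star D.t) • v)
      rw [sigmaBwd_sigmaFwd, ← mul_smul, Alg.Y_mul_X, D.star_t])
    (by
      refine AddMonoidHom.ext fun φ => Subtype.ext (AddMonoidHom.ext fun v => ?_)
      change sigmaFwd D m (sigmaBwd D m (φ.1 (Alg.X D • Alg.Y D • v)))
        = φ.1 (Alg.ofR D (D.star (D.sigma D.t)) • v)
      rw [sigmaFwd_sigmaBwd, ← mul_smul, Alg.X_mul_Y, ← D.sigma_star, D.star_t])
    (fun r => by
      refine AddMonoidHom.ext fun φ => Subtype.ext (AddMonoidHom.ext fun v => ?_)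
      change sigmaFwd D m (φ.1 (Alg.ofR D (D.star r) • Alg.Y D • v))
        = sigmaFwd D m (φ.1 (Alg.Y D • Alg.ofR D (D.star (D.sigma r)) • v))
      rw [← mul_smul, ← mul_smul, Alg.Y_mul_ofR, ← D.sigma_star, RingEquiv.symm_apply_apply])
    (fun r => by
      refine AddMonoidHom.ext fun φ => Subtype.ext (AddMonoidHom.ext fun v => ?_)
      change sigmaBwd D m (φ.1 (Alg.ofR D (D.star r) • Alg.X D • v))
        = sigmaBwd D m (φ.1 (Alg.X D • Alg.ofR D (D.star (D.sigma.symm r)) • v))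
      rw [← mul_smul, ← mul_smul, Alg.X_mul_ofR, D.sigma_star, RingEquiv.apply_symm_apply])

instance : Module (Alg D) (Dual D V m) := Module.compHom (Dual D V m) (dualAction D V m)

end modules

/-! ### Skew Laurent polynomials -/

section skew

variable {k : Type u} [Ring k]

/-- The action of `ℤ` on `k` by powers of the automorphism `τ`. -/
abbrev tauAction (τ : RingAut k) : MulSemiringAction (Multiplicative ℤ) k :=
  MulSemiringAction.compHom k (zpowersHom (RingAut k) τ)

/-- The skew Laurent polynomial ring `k[x, x⁻¹; τ]`, with `x a = τ(a) x`. -/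
def SkewLaurent (_τ : RingAut k) : Type u := SkewMonoidAlgebra k (Multiplicative ℤ)

instance (τ : RingAut k) : Ring (SkewLaurent τ) :=
  letI := tauAction τ
  inferInstanceAs (Ring (SkewMonoidAlgebra k (Multiplicative ℤ)))

/-- The element `a xⁿ`. -/
def SkewLaurent.monomial (τ : RingAut k) (n : ℤ) (a : k) : SkewLaurent τ :=
  SkewMonoidAlgebra.single (Multiplicative.ofAdd n) a

theorem SkewLaurent.monomial_mul_monomial (τ : RingAut k) (n n' : ℤ) (a b : k) :
    monomial τ n a * monomial τ n' b = monomial τ (n + n') (a * (τ ^ n) b) :=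
  letI := tauAction τ
  SkewMonoidAlgebra.single_mul_single

/-- The left module `P/Pf`. -/
abbrev quotLeft {P : Type u} [Ring P] (f : P) : Type u := P ⧸ (Submodule.span P {f})

/-- `f` is indecomposable: the left module `P/Pf` is indecomposable, i.e. nonzero and not the
direct sum of two nonzero submodules. -/
def IsIndecomposable {P : Type u} [Ring P] (f : P) : Prop :=
  Nontrivial (quotLeft f) ∧
    ∀ U W : Submodule P (quotLeft f), IsCompl U W → U = ⊥ ∨ W = ⊥

/-- `f` and `g` are similar: `P/Pf ≅ P/Pg` as left `P`-modules. -/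
def IsSimilar {P : Type u} [Ring P] (f g : P) : Prop :=
  Nonempty (quotLeft f ≃ₗ[P] quotLeft g)

/-- Coefficients `α₀, …, α_d` of a polynomial with `α₀ ≠ 0 ≠ α_d`. -/
structure Coeffs (k : Type u) [Zero k] where
  /-- the degree `d` -/
  d : ℕ
  /-- the coefficients -/
  α : Fin (d + 1) → k
  zero_ne : α 0 ≠ 0
  last_ne : α (Fin.last d) ≠ 0

/-- The element `α₀ + α₁ x + ⋯ + α_d x^d` of `k[x, x⁻¹; τ]`. -/
def Coeffs.toSkew (τ : RingAut k) (f : Coeffs k) : SkewLaurent τ :=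
  ∑ i : Fin (f.d + 1), SkewLaurent.monomial τ (i : ℕ) (f.α i)

end skew

/-- The companion matrix `F_f`: its last column is `-α₀/α_d, …, -α_{d-1}/α_d`, and it has ones
below the diagonal. -/
def companion {k : Type u} [Field k] (f : Coeffs k) : Matrix (Fin f.d) (Fin f.d) k :=
  Matrix.of fun i j =>
    if (j : ℕ) + 1 = f.d then -f.α i.castSucc / f.α (Fin.last f.d)
    else if (i : ℕ) = j + 1 then 1 else 0

theorem isUnit_companion {k : Type u} [Field k] (f : Coeffs k) : IsUnit (companion f) := by
  rw [← Matrix.mulVec_injective_iff_isUnit]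
  refine (injective_iff_map_eq_zero (companion f).mulVecLin).mpr fun v hv => ?_
  have hv : ∀ i, ∑ j, companion f i j * v j = 0 := fun i => congrFun hv i
  have hlast : ∀ j : Fin f.d, (j : ℕ) + 1 = f.d → v j = 0 := by
    intro j hj
    have h := hv ⟨0, by omega⟩
    rw [Finset.sum_eq_single j] at h
    · have h0 := f.zero_ne
      have h1 := f.last_ne
      simp only [companion, Matrix.of_apply, hj, if_true] at h
      rcases mul_eq_zero.mp h with h | h
      · exact absurd h (div_ne_zero (neg_ne_zero.mpr h0) h1)
      · exact h
    · intro b _ hb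
      have : (b : ℕ) + 1 ≠ f.d := fun hc => hb (Fin.ext (by omega))
      simp [companion, this]
    · simp
  funext j
  by_cases hj : (j : ℕ) + 1 = f.d
  · exact hlast j hj
  · have h := hv ⟨j + 1, by omega⟩
    rw [Finset.sum_eq_single j] at h
    · simpa [companion, hj] using h
    · intro b _ hb
      by_cases hc : (b : ℕ) + 1 = f.d
      · rw [hlast b hc, mul_zero]
      · have : (j : ℕ) ≠ b := fun h => hb (Fin.ext h.symm)
        simp [companion, hc, this]
    · simp

/-! ### The automorphism `τ` of `K_ω`, conjugation, and the polynomial `f^♯` -/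

theorem maxPerm_pow (e : RingAut R) (j : ℕ) : maxPerm (e ^ j : RingAut R) = maxPerm e ^ j := by
  induction j with
  | zero => rfl
  | succ j ih =>
    rw [pow_succ, pow_succ, ← ih]
    rfl

/-- `σ^p` fixes `𝔪`, where `p = |ω|`. -/
theorem maxPerm_period (D : Datum R) (m : MaximalSpectrum R) :
    maxPerm ((D.sigma : RingAut R) ^ Nat.card (orbit D m) : RingAut R) m = m := by
  rw [maxPerm_pow]
  rcases finite_or_infinite (orbit D m) with h | h
  · have := Fintype.ofFinite (orbit D m)
    have : Fintype (MulAction.orbit (Subgroup.zpowers (maxPerm D.sigma)) m) := this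
    have h1 := MulAction.minimalPeriod_eq_card (a := maxPerm D.sigma) (b := m)
    have h2 : Nat.card (orbit D m)
        = Function.minimalPeriod ((maxPerm D.sigma) • ·) m := by
      rw [h1, ← Nat.card_eq_fintype_card]; rfl
    rw [h2]
    exact (MulAction.pow_smul_eq_iff_minimalPeriod_dvd (a := maxPerm D.sigma) (b := m)).mpr dvd_rfl
  · rw [Nat.card_eq_zero_of_infinite, pow_zero]; rfl

/-- The automorphism `τ = σ^p` of `K_ω = R/𝔪`, where `p = |ω|`. -/
def tau (D : Datum R) (m : MaximalSpectrum R) : RingAut (K m) where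
  toFun := up ((D.sigma : RingAut R) ^ Nat.card (orbit D m) : RingAut R) (maxPerm_period D m)
  invFun := down ((D.sigma : RingAut R) ^ Nat.card (orbit D m) : RingAut R) (maxPerm_period D m)
  left_inv := down_up _ _
  right_inv := up_down _ _
  map_mul' := map_mul _
  map_add' := map_add _

/-- The ring `P = K_ω[x, x⁻¹; τ]`. -/
abbrev P (D : Datum R) (m : MaximalSpectrum R) : Type u := SkewLaurent (tau D m)

/-- The element `f = α₀ + α₁ x + ⋯ + α_d x^d` of `P`. -/
abbrev poly (D : Datum R) (m : MaximalSpectrum R) (f : Coeffs (K m)) : P D m :=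
  f.toSkew (tau D m)

/-- Conjugation on `K_ω`, for a real orbit `ω`. -/
def conj (D : Datum R) (m : MaximalSpectrum R) (hreal : IsReal D m) : K m →+* K m :=
  up D.star (hreal m (base D m).2)

/-- `ξ = σ(t) σ²(t) ⋯ σ^p(t)` modulo `𝔪`, where `p = |ω|`. -/
def xi (D : Datum R) (m : MaximalSpectrum R) : K m :=
  Ideal.Quotient.mk m.asIdeal
    (∏ i ∈ Finset.Icc 1 (Nat.card (orbit D m)), ((D.sigma : RingAut R) ^ i) D.t)

theorem xi_ne_zero (D : Datum R) (m : MaximalSpectrum R) (hnb : NoBreaks D m) : xi D m ≠ 0 := by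
  rw [xi, Ne, Ideal.Quotient.eq_zero_iff_mem, m.isMaximal.isPrime.prod_mem_iff]
  rintro ⟨i, -, h⟩
  refine hnb ((maxPerm D.sigma ^ i)⁻¹ m) ?_ ?_
  · exact MulAction.mem_orbit (m : MaximalSpectrum R)
      (⟨(maxPerm D.sigma ^ i)⁻¹, Subgroup.inv_mem _ (Subgroup.npow_mem_zpowers _ i)⟩ :
        Subgroup.zpowers (maxPerm D.sigma))
  · rw [← maxPerm_pow]
    exact h

/-- `{j}_ξ = ξ τ(ξ) ⋯ τ^{j-1}(ξ)`. -/
def xiNum (D : Datum R) (m : MaximalSpectrum R) (j : ℕ) : K m :=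
  ∏ i ∈ Finset.range j, (tau D m ^ i) (xi D m)

theorem xiNum_ne_zero (D : Datum R) (m : MaximalSpectrum R) (hnb : NoBreaks D m) (j : ℕ) :
    xiNum D m j ≠ 0 :=
  Finset.prod_ne_zero_iff.mpr fun i _ =>
    (map_ne_zero_iff _ (tau D m ^ i).injective).mpr (xi_ne_zero D m hnb)

/-- `f^♯ = ∑ {j}_ξ τ^j(conj α_{d-j}) x^j`. -/
def sharp (D : Datum R) (m : MaximalSpectrum R) (hreal : IsReal D m) (hnb : NoBreaks D m)
    (f : Coeffs (K m)) : Coeffs (K m) where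
  d := f.d
  α j := xiNum D m j * (tau D m ^ (j : ℕ)) (conj D m hreal (f.α j.rev))
  zero_ne := by
    refine mul_ne_zero (xiNum_ne_zero D m hnb _) ((map_ne_zero_iff _ (RingEquiv.injective _)).mpr ?_)
    rw [Fin.rev_zero]
    exact (map_ne_zero_iff _ (conj D m hreal).injective).mpr f.last_ne
  last_ne := by
    refine mul_ne_zero (xiNum_ne_zero D m hnb _) ((map_ne_zero_iff _ (RingEquiv.injective _)).mpr ?_)
    rw [Fin.rev_last]
    exact (map_ne_zero_iff _ (conj D m hreal).injective).mpr f.zero_ne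

/-! ### The module `V(ω, f)` -/

section Vmod

variable (D : Datum R) (m : MaximalSpectrum R) (f : Coeffs (K m))

/-- The additive group of `V(ω, f)`: the direct sum of the `(K_𝔫)^d` for `𝔫 ∈ ω`. -/
def V : Type u := ⨁ n : orbit D m, (Fin f.d → K n.1)

instance : AddCommGroup (V D m f) :=
  inferInstanceAs (AddCommGroup (⨁ n : orbit D m, (Fin f.d → K n.1)))

instance : Module R (V D m f) :=
  inferInstanceAs (Module R (⨁ n : orbit D m, (Fin f.d → K n.1)))

open Classical in
/-- The inclusion of `(K_𝔫)^d` into `V(ω, f)`. -/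
def V.of (n : orbit D m) : (Fin f.d → K n.1) →+ V D m f :=
  DirectSum.of (fun n : orbit D m => Fin f.d → K n.1) n

open Classical in
/-- The family of matrices over the `K_𝔫` which is `F` at `𝔫 = 𝔪(ω)` and the identity
elsewhere. -/
def matAt (F : Matrix (Fin f.d) (Fin f.d) (K m)) (n : orbit D m) :
    Matrix (Fin f.d) (Fin f.d) (K n.1) :=
  Function.update (β := fun n : orbit D m => Matrix (Fin f.d) (Fin f.d) (K n.1))
    (fun _ => 1) (base D m) F n

/-- The components `(K_𝔫)^d → (K_{σ(𝔫)})^d` of the action of `X`: `v ↦ σ(t v)` if `𝔫 ≠ 𝔪(ω)` and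
`v ↦ σ(F_f t v)` if `𝔫 = 𝔪(ω)`. -/
def Xcomp (n : orbit D m) (n' : MaximalSpectrum R) (h : maxPerm D.sigma n.1 = n') :
    (Fin f.d → K n.1) →+ (Fin f.d → K n') where
  toFun v := up D.sigma h ∘ (matAt D m f (companion f) n).mulVec (D.t • v)
  map_zero' := by funext i; simp
  map_add' v w := by funext i; simp [smul_add, Matrix.mulVec_add]

/-- The components `(K_𝔫)^d → (K_{σ⁻¹(𝔫)})^d` of the action of `Y`: `v ↦ σ⁻¹(v)` if
`σ⁻¹(𝔫) ≠ 𝔪(ω)` and `v ↦ F_f⁻¹ σ⁻¹(v)` if `σ⁻¹(𝔫) = 𝔪(ω)`; here `n` is `σ⁻¹(𝔫)`. -/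
def Ycomp (n : orbit D m) (n' : MaximalSpectrum R) (h : maxPerm D.sigma n.1 = n') :
    (Fin f.d → K n') →+ (Fin f.d → K n.1) where
  toFun v := (matAt D m f (companion f)⁻¹ n).mulVec (down D.sigma h ∘ v)
  map_zero' := by
    have : (down D.sigma h ∘ (0 : Fin f.d → K n')) = 0 := by funext i; simp
    rw [this, Matrix.mulVec_zero]
  map_add' v w := by
    have : (down D.sigma h ∘ (v + w)) = (down D.sigma h ∘ v) + (down D.sigma h ∘ w) := by
      funext i; simp
    rw [this, Matrix.mulVec_add]

open Classical in
/-- The action of `X` on `V(ω, f)`. -/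
def XV : AddMonoid.End (V D m f) :=
  (DirectSum.toAddMonoid fun n => (V.of D m f (shift D m n)).comp
    (Xcomp D m f n _ (shift_spec D m n)) :
      (⨁ n : orbit D m, (Fin f.d → K n.1)) →+ V D m f)

open Classical in
/-- The action of `Y` on `V(ω, f)`. -/
def YV : AddMonoid.End (V D m f) :=
  (DirectSum.toAddMonoid fun n => (V.of D m f ((shift D m).symm n)).comp
    (Ycomp D m f ((shift D m).symm n) _ (shift_symm_spec D m n)) :
      (⨁ n : orbit D m, (Fin f.d → K n.1)) →+ V D m f)

theorem XV_of (n : orbit D m) (v : Fin f.d → K n.1) :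
    XV D m f (V.of D m f n v) = V.of D m f (shift D m n) (Xcomp D m f n _ (shift_spec D m n) v) := by
  classical
  exact DirectSum.toAddMonoid_of _ _ _

theorem YV_of (n : orbit D m) (v : Fin f.d → K n.1) :
    YV D m f (V.of D m f n v) = V.of D m f ((shift D m).symm n)
      (Ycomp D m f ((shift D m).symm n) _ (shift_symm_spec D m n) v) := by
  classical
  exact DirectSum.toAddMonoid_of _ _ _

theorem smul_of (r : R) (n : orbit D m) (v : Fin f.d → K n.1) :
    r • V.of D m f n v = V.of D m f n (r • v) := by
  classical
  exact (DirectSum.of_smul R (M := fun n : orbit D m => Fin f.d → K n.1) n r v).symm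

variable {D m f}

theorem V.induction {p : V D m f → Prop} (a : V D m f)
    (h0 : p 0) (hof : ∀ n v, p (V.of D m f n v)) (hadd : ∀ a b, p a → p b → p (a + b)) : p a := by
  classical
  exact DirectSum.induction_on a h0 hof hadd

theorem V.hom_ext {g h : AddMonoid.End (V D m f)}
    (H : ∀ n v, g (V.of D m f n v) = h (V.of D m f n v)) : g = h := by
  refine AddMonoidHom.ext fun a => ?_
  induction a using V.induction with
  | h0 => exact (AddMonoidHom.map_zero g).trans (AddMonoidHom.map_zero h).symm
  | hof n v => exact H n v
  | hadd a b ha hb =>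
    exact (AddMonoidHom.map_add g a b).trans
      ((congrArg₂ (· + ·) ha hb).trans (AddMonoidHom.map_add h a b).symm)

variable (D m f)

theorem matAt_base (F : Matrix (Fin f.d) (Fin f.d) (K m)) :
    matAt D m f F (base D m) = F := by
  classical
  exact Function.update_self (β := fun n : orbit D m => Matrix (Fin f.d) (Fin f.d) (K n.1)) _ _ _

theorem matAt_of_ne (F : Matrix (Fin f.d) (Fin f.d) (K m)) (n : orbit D m) (hn : n ≠ base D m) :
    matAt D m f F n = 1 := by
  classical
  exact Function.update_of_ne (β := fun n : orbit D m => Matrix (Fin f.d) (Fin f.d) (K n.1)) hn _ _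

theorem matAt_mul_matAt (F G : Matrix (Fin f.d) (Fin f.d) (K m)) (h : F * G = 1)
    (n : orbit D m) : matAt D m f F n * matAt D m f G n = 1 := by
  by_cases hn : n = base D m
  · subst hn
    rw [matAt_base, matAt_base]
    exact h
  · rw [matAt_of_ne D m f F n hn, matAt_of_ne D m f G n hn, one_mul]

theorem up_smul {n n' : MaximalSpectrum R} (h : maxPerm D.sigma n = n') (r : R) (a : K n) :
    up D.sigma h (r • a) = D.sigma r • up D.sigma h a := by
  obtain ⟨s, rfl⟩ := Ideal.Quotient.mk_surjective a
  change up D.sigma h (Ideal.Quotient.mk _ (r * s)) = D.sigma r • up D.sigma h _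
  simp only [up, Ideal.quotientMap_mk, RingHom.coe_coe, map_mul]
  rfl

theorem down_smul {n n' : MaximalSpectrum R} (h : maxPerm D.sigma n = n') (r : R) (a : K n') :
    down D.sigma h (r • a) = D.sigma.symm r • down D.sigma h a := by
  obtain ⟨s, rfl⟩ := Ideal.Quotient.mk_surjective a
  change down D.sigma h (Ideal.Quotient.mk _ (r * s)) = D.sigma.symm r • down D.sigma h _
  simp only [down, Ideal.quotientMap_mk, RingHom.coe_coe, map_mul]
  rfl

theorem Xcomp_smul (n : orbit D m) (n' : MaximalSpectrum R) (h : maxPerm D.sigma n.1 = n')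
    (r : R) (v : Fin f.d → K n.1) :
    Xcomp D m f n n' h (r • v) = D.sigma r • Xcomp D m f n n' h v := by
  funext i
  change up D.sigma h ((matAt D m f (companion f) n).mulVec (D.t • r • v) i)
    = D.sigma r • up D.sigma h ((matAt D m f (companion f) n).mulVec (D.t • v) i)
  rw [smul_comm, Matrix.mulVec_smul, Pi.smul_apply, up_smul]

theorem Ycomp_smul (n : orbit D m) (n' : MaximalSpectrum R) (h : maxPerm D.sigma n.1 = n')
    (r : R) (v : Fin f.d → K n') :
    Ycomp D m f n n' h (r • v) = D.sigma.symm r • Ycomp D m f n n' h v := by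
  have : down D.sigma h ∘ (r • v) = D.sigma.symm r • (down D.sigma h ∘ v) := by
    funext i
    exact down_smul D h r (v i)
  change (matAt D m f (companion f)⁻¹ n).mulVec (down D.sigma h ∘ (r • v))
    = D.sigma.symm r • (matAt D m f (companion f)⁻¹ n).mulVec (down D.sigma h ∘ v)
  rw [this, Matrix.mulVec_smul]

theorem Ycomp_Xcomp (n : orbit D m) (n' : MaximalSpectrum R) (h : maxPerm D.sigma n.1 = n')
    (v : Fin f.d → K n.1) :
    Ycomp D m f n n' h (Xcomp D m f n n' h v) = D.t • v := by
  have : down D.sigma h ∘ (up D.sigma h ∘ (matAt D m f (companion f) n).mulVec (D.t • v))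
      = (matAt D m f (companion f) n).mulVec (D.t • v) := by
    funext i; exact down_up _ _ _
  change (matAt D m f (companion f)⁻¹ n).mulVec (down D.sigma h ∘
    (up D.sigma h ∘ (matAt D m f (companion f) n).mulVec (D.t • v))) = D.t • v
  rw [this, Matrix.mulVec_mulVec, matAt_mul_matAt, Matrix.one_mulVec]
  exact Matrix.nonsing_inv_mul _ ((Matrix.isUnit_iff_isUnit_det _).mp (isUnit_companion f))

theorem Xcomp_Ycomp (n : orbit D m) (n' : MaximalSpectrum R) (h : maxPerm D.sigma n.1 = n')
    (v : Fin f.d → K n') :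
    Xcomp D m f n n' h (Ycomp D m f n n' h v) = D.sigma D.t • v := by
  funext i
  change up D.sigma h ((matAt D m f (companion f) n).mulVec
    (D.t • (matAt D m f (companion f)⁻¹ n).mulVec (down D.sigma h ∘ v)) i) = D.sigma D.t • v i
  rw [Matrix.mulVec_smul, Matrix.mulVec_mulVec, matAt_mul_matAt, Matrix.one_mulVec, Pi.smul_apply,
    up_smul, Function.comp_apply, up_down]
  exact Matrix.mul_nonsing_inv _ ((Matrix.isUnit_iff_isUnit_det _).mp (isUnit_companion f))

/-- The action of `A` on `V(ω, f)`. -/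
def VAction : Alg D →+* AddMonoid.End (V D m f) :=
  Alg.lift D (Module.toAddMonoidEnd R (V D m f)) (XV D m f) (YV D m f)
    (V.hom_ext fun n v => by
      change YV D m f (XV D m f (V.of D m f n v)) = D.t • V.of D m f n v
      have key : ∀ (n n1 : orbit D m) (n' : MaximalSpectrum R) (_ : n1 = n)
          (h : maxPerm D.sigma n1.1 = n') (h0 : maxPerm D.sigma n.1 = n') (v : Fin f.d → K n.1),
          V.of D m f n1 (Ycomp D m f n1 n' h (Xcomp D m f n n' h0 v))
            = V.of D m f n (D.t • v) := by
        rintro n _ n' rfl h h0 v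
        rw [Ycomp_Xcomp]
      rw [XV_of, YV_of, smul_of]
      exact key _ _ _ (Equiv.symm_apply_apply _ _) _ _ _)
    (V.hom_ext fun n v => by
      change XV D m f (YV D m f (V.of D m f n v)) = D.sigma D.t • V.of D m f n v
      have key : ∀ (n n1 n0 : orbit D m) (_ : n1 = n)
          (h : maxPerm D.sigma n0.1 = n1.1) (h0 : maxPerm D.sigma n0.1 = n.1)
          (v : Fin f.d → K n.1),
          V.of D m f n1 (Xcomp D m f n0 n1.1 h (Ycomp D m f n0 n.1 h0 v))
            = V.of D m f n (D.sigma D.t • v) := by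
        rintro n _ n' rfl h h0 v
        rw [Xcomp_Ycomp]
      rw [YV_of, XV_of, smul_of]
      exact key _ _ _ (Equiv.apply_symm_apply _ _) _ _ _)
    (fun r => V.hom_ext fun n v => by
      change XV D m f (r • V.of D m f n v) = D.sigma r • XV D m f (V.of D m f n v)
      rw [smul_of, XV_of, XV_of, smul_of, Xcomp_smul])
    (fun r => V.hom_ext fun n v => by
      change YV D m f (r • V.of D m f n v) = D.sigma.symm r • YV D m f (V.of D m f n v)
      rw [smul_of, YV_of, YV_of, smul_of, Ycomp_smul])

instance : Module (Alg D) (V D m f) := Module.compHom (V D m f) (VAction D m f)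

end Vmod

end GenWeyl

end

/-! Everything is reduced to matrices over K_ω. In the basis 1, x, …, x^{d-1} the module P/Pf is
K_ω^d with x acting by v ↦ F_f τ(v) (`Model.equivQuot`), so the homomorphisms P/Pf → P/Pg are the
matrices G with G F_f = F_g τ(G) (`Intertwines`). Similarity means that such a G is invertible, and
indecomposability means that d > 0 and that 0 and 1 are the only idempotents among the G with f = g.

The same matrices describe the modules V(ω, f). A matrix G can be carried along the orbit by powers
of σ, and the relation above is exactly what makes it commute with X when the orbit passes 𝔪(ω).
Conversely Y^p acts on the weight space at 𝔪(ω) by w ↦ F_f⁻¹ τ⁻¹(w), so an isomorphism of the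
modules gives back an invertible G. Hence V(ω, f) ≅ V(ω, g) if and only if f and g are similar
(`nonempty_V_equiv_iff`).

For the dual, pair vectors with conjugated vectors on each weight space. Compatibility with X
replaces F_f by the inverse of its conjugate transpose, up to the product of the factors σ(t) met
along the orbit, which is ξ after one round. The resulting matrix is not a companion matrix, but the
upper triangular matrix L with entries {i}_ξ τ^i(conj α_{j-i}) turns it into one: ξ F_{f♯} τ(L)
conj(F_f)ᵀ = L (`companion_sharp`). This identity is the origin of the formula for f♯. The diagonal
of L is nonzero, and its inverse defines the isomorphism V(ω, f♯) → V(ω, f)♯ (`V.toDual_bijective`).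
Combined with conjugate transposition, the identity also moves idempotents from f♯ to f, which gives
the indecomposability of f♯ (`isIndecomposable_sharp`).

Finally, an admissible form is the same as a homomorphism V → V♯. Weight spaces of V and V♯ have the
same finite dimension, so the form is non-degenerate exactly when the homomorphism is an isomorphism
(`isPseudoUnitarizable_V_iff`). Thus V(ω, f) is pseudo-unitarizable if and only if V(ω, f) ≅ V(ω,
f)♯ ≅ V(ω, f♯), that is, if and only if f is similar to f♯. -/

noncomputable section

open scoped Matrix

namespace GenWeyl

universe u v

/-! ### Modules P/Pf over skew Laurent polynomials in matrix form. -/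

section skewModel

variable {k : Type u} [Field k] (τ : RingAut k)

/-- The inclusion of the coefficient field into the skew Laurent polynomials. -/
def SkewLaurent.C : k →+* SkewLaurent τ :=
  letI := tauAction τ
  SkewMonoidAlgebra.singleOneRingHom

theorem SkewLaurent.C_apply (a : k) : SkewLaurent.C τ a = SkewLaurent.monomial τ 0 a := rfl

theorem SkewLaurent.monomial_zero_one : SkewLaurent.monomial τ 0 1 = 1 :=
  (SkewLaurent.C τ).map_one

theorem SkewLaurent.C_mul_monomial (n : ℤ) (a b : k) :
    SkewLaurent.C τ a * SkewLaurent.monomial τ n b = SkewLaurent.monomial τ n (a * b) := by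
  rw [SkewLaurent.C_apply, SkewLaurent.monomial_mul_monomial]
  simp

theorem SkewLaurent.x_mul_monomial (n : ℤ) (a : k) :
    SkewLaurent.monomial τ 1 1 * SkewLaurent.monomial τ n a
      = SkewLaurent.monomial τ (n + 1) (τ a) := by
  rw [SkewLaurent.monomial_mul_monomial, one_mul, zpow_one, add_comm]

theorem SkewLaurent.induction {p : SkewLaurent τ → Prop} (h0 : p 0)
    (hadd : ∀ a b, p a → p b → p (a + b)) (hm : ∀ n a, p (SkewLaurent.monomial τ n a))
    (a : SkewLaurent τ) : p a := by
  refine SkewMonoidAlgebra.induction_on (k := k) (G := Multiplicative ℤ) a h0 ?_ ?_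
  · exact fun g b => hm (Multiplicative.toAdd g) b
  · exact fun {f g} hf hg => hadd f g hf hg

/-- Additive maps that commute with scalars and with `x` are linear over the skew Laurent
polynomials. -/
theorem SkewLaurent.map_smul_of_C_x {M N : Type*} [AddCommGroup M] [AddCommGroup N]
    [Module (SkewLaurent τ) M] [Module (SkewLaurent τ) N] (φ : M →+ N)
    (hC : ∀ a v, φ (SkewLaurent.C τ a • v) = SkewLaurent.C τ a • φ v)
    (hx : ∀ v, φ (SkewLaurent.monomial τ 1 1 • v) = SkewLaurent.monomial τ 1 1 • φ v)
    (p : SkewLaurent τ) (v : M) : φ (p • v) = p • φ v := by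
  -- Commutation with x⁻¹ is automatic: apply the hypothesis for x to x⁻¹v and cancel x.
  have hy : ∀ v, φ (SkewLaurent.monomial τ (-1) 1 • v)
      = SkewLaurent.monomial τ (-1) 1 • φ v := by
    intro v
    have h1 : SkewLaurent.monomial τ (-1) 1 * SkewLaurent.monomial τ 1 1 = 1 := by
      rw [SkewLaurent.monomial_mul_monomial, map_one, one_mul]
      exact SkewLaurent.monomial_zero_one τ
    have h2 : SkewLaurent.monomial τ 1 1 * SkewLaurent.monomial τ (-1) 1 = 1 := by
      rw [SkewLaurent.monomial_mul_monomial, map_one, one_mul]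
      exact SkewLaurent.monomial_zero_one τ
    have h3 := hx (SkewLaurent.monomial τ (-1) 1 • v)
    rw [← mul_smul, h2, one_smul] at h3
    rw [h3, ← mul_smul, h1, one_smul]
  have hpow : ∀ (n : ℤ) v, φ (SkewLaurent.monomial τ n 1 • v)
      = SkewLaurent.monomial τ n 1 • φ v := by
    intro n
    induction n with
    | zero => intro v; rw [SkewLaurent.monomial_zero_one, one_smul, one_smul]
    | succ n ih =>
      intro v
      have : SkewLaurent.monomial τ ((n : ℤ) + 1) 1
          = SkewLaurent.monomial τ n 1 * SkewLaurent.monomial τ 1 1 := by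
        rw [SkewLaurent.monomial_mul_monomial, map_one, one_mul]
      rw [this, mul_smul, ih, hx, mul_smul]
    | pred n ih =>
      intro v
      have : SkewLaurent.monomial τ (-(n : ℤ) - 1) 1
          = SkewLaurent.monomial τ (-(n : ℤ)) 1 * SkewLaurent.monomial τ (-1) 1 := by
        rw [SkewLaurent.monomial_mul_monomial, map_one, one_mul, sub_eq_add_neg]
      rw [this, mul_smul, ih, hy, mul_smul]
  induction p using SkewLaurent.induction with
  | h0 => simp
  | hadd a b ha hb => rw [add_smul, map_add, ha, hb, add_smul]
  | hm n a =>
    have : SkewLaurent.monomial τ n a = SkewLaurent.C τ a * SkewLaurent.monomial τ n 1 := by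
      rw [SkewLaurent.C_mul_monomial, mul_one]
    rw [this, mul_smul, hC, hpow, mul_smul]

/-- The coordinate space `k^d` on which `x` acts by `v ↦ F_f τ(v)`. -/
abbrev Model (_τ : RingAut k) (f : Coeffs k) : Type u := Fin f.d → k

theorem map_comp_mulVec {S T : Type*} [CommRing S] [CommRing T] {ι κ : Type*} [Fintype κ]
    (e : S →+* T) (A : Matrix ι κ S) (v : κ → S) :
    e ∘ A.mulVec v = (A.map e).mulVec (e ∘ v) := by
  funext i
  exact e.map_mulVec A v i

theorem companion_mul_inv (f : Coeffs k) : companion f * (companion f)⁻¹ = 1 :=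
  Matrix.mul_nonsing_inv _ ((Matrix.isUnit_iff_isUnit_det _).mp (isUnit_companion f))

theorem companion_inv_mul (f : Coeffs k) : (companion f)⁻¹ * companion f = 1 :=
  Matrix.nonsing_inv_mul _ ((Matrix.isUnit_iff_isUnit_det _).mp (isUnit_companion f))

/-- The operator `v ↦ F_f τ(v)`. -/
def Model.xEnd (f : Coeffs k) : (AddMonoid.End (Model τ f))ˣ where
  val :=
    { toFun := fun v => (companion f).mulVec (τ ∘ v)
      map_zero' := by
        have : (τ ∘ (0 : Fin f.d → k)) = 0 := by funext i; simp
        rw [this, Matrix.mulVec_zero]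
      map_add' := fun v w => by
        have : τ ∘ (v + w) = τ ∘ v + τ ∘ w := by funext i; simp
        rw [this, Matrix.mulVec_add] }
  inv :=
    { toFun := fun v => τ.symm ∘ (companion f)⁻¹.mulVec v
      map_zero' := by
        rw [Matrix.mulVec_zero]
        funext i; simp
      map_add' := fun v w => by
        rw [Matrix.mulVec_add]
        funext i
        exact map_add τ.symm _ _ }
  val_inv := by
    refine AddMonoidHom.ext fun v => ?_
    have : τ ∘ (τ.symm ∘ (companion f)⁻¹.mulVec v) = (companion f)⁻¹.mulVec v :=
      funext fun i => τ.apply_symm_apply _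
    change (companion f).mulVec (τ ∘ (τ.symm ∘ (companion f)⁻¹.mulVec v)) = v
    rw [this, Matrix.mulVec_mulVec, companion_mul_inv, Matrix.one_mulVec]
  inv_val := by
    refine AddMonoidHom.ext fun v => ?_
    change τ.symm ∘ (companion f)⁻¹.mulVec ((companion f).mulVec (τ ∘ v)) = v
    rw [Matrix.mulVec_mulVec, companion_inv_mul, Matrix.one_mulVec]
    exact funext fun i => τ.symm_apply_apply _

/-- The operator is τ-semilinear, and induction in both directions extends this to all its integer
powers. It is the compatibility needed to make k^d a module over the skew Laurent ring. -/
theorem Model.xEnd_comm (f : Coeffs k) (n : ℤ) (a : k) :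
    Module.toAddMonoidEnd k (Model τ f) ((τ ^ n) a) * ((Model.xEnd τ f ^ n :
      (AddMonoid.End (Model τ f))ˣ) : AddMonoid.End (Model τ f))
      = ((Model.xEnd τ f ^ n : (AddMonoid.End (Model τ f))ˣ) : AddMonoid.End (Model τ f))
        * Module.toAddMonoidEnd k (Model τ f) a := by
  have h1 : ∀ a, Module.toAddMonoidEnd k (Model τ f) (τ a) * (Model.xEnd τ f).val
      = (Model.xEnd τ f).val * Module.toAddMonoidEnd k (Model τ f) a := by
    intro a
    refine AddMonoidHom.ext fun v => ?_
    change τ a • (companion f).mulVec (τ ∘ v) = (companion f).mulVec (τ ∘ (a • (v : Fin f.d → k)))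
    rw [← Matrix.mulVec_smul]
    congr 1
    funext i
    simp
  induction n generalizing a with
  | zero => simp
  | succ n ih =>
    rw [zpow_add_one, zpow_add_one, Units.val_mul, ← mul_assoc, RingAut.mul_apply, ih, mul_assoc,
      h1, mul_assoc]
  | pred n ih =>
    rw [zpow_sub_one, zpow_sub_one, Units.val_mul, ← mul_assoc, RingAut.mul_apply, ih, mul_assoc,
      mul_assoc]
    congr 1
    have h2 := h1 (τ⁻¹ a)
    rw [← RingAut.mul_apply, mul_inv_cancel, RingAut.one_apply] at h2
    rw [Units.mul_inv_eq_iff_eq_mul, mul_assoc, h2, ← mul_assoc, Units.inv_mul, one_mul]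

/-- The action of the skew Laurent polynomials on `k^d`. -/
def Model.action (f : Coeffs k) : SkewLaurent τ →+* AddMonoid.End (Model τ f) :=
  letI := tauAction τ
  SkewMonoidAlgebra.liftNCRingHom (Module.toAddMonoidEnd k (Model τ f))
    ((Units.coeHom _).comp (zpowersHom _ (Model.xEnd τ f)))
    (fun {a n} => Model.xEnd_comm τ f (Multiplicative.toAdd n) a)

instance (f : Coeffs k) : Module (SkewLaurent τ) (Model τ f) :=
  Module.compHom (Model τ f) (Model.action τ f)

theorem Model.monomial_smul (f : Coeffs k) (n : ℤ) (a : k) (v : Model τ f) :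
    SkewLaurent.monomial τ n a • v = a • ((Model.xEnd τ f ^ n :
      (AddMonoid.End (Model τ f))ˣ) : AddMonoid.End (Model τ f)) v := by
  let _ := tauAction τ
  have : Model.action τ f (SkewLaurent.monomial τ n a) = Module.toAddMonoidEnd k (Model τ f) a *
      ((Model.xEnd τ f ^ n : (AddMonoid.End (Model τ f))ˣ) : AddMonoid.End (Model τ f)) := by
    refine (SkewMonoidAlgebra.sum_single_index ?_).trans ?_
    · simp
    · simp
  exact congrArg (fun e : AddMonoid.End (Model τ f) => e v) this

theorem Model.C_smul (f : Coeffs k) (a : k) (v : Model τ f) :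
    SkewLaurent.C τ a • v = a • v := by
  rw [SkewLaurent.C_apply, Model.monomial_smul]
  simp

theorem Model.x_smul (f : Coeffs k) (v : Model τ f) :
    SkewLaurent.monomial τ 1 1 • v = (companion f).mulVec (τ ∘ v) := by
  rw [Model.monomial_smul, one_smul, zpow_one]
  rfl

/-- If `α₀ q₀ + ⋯ + α_d q_d = 0`, then the columns of the companion matrix express `q_{j+1}`
through `q₀, …, q_{d-1}`. -/
theorem sum_companion_smul {M : Type*} [AddCommGroup M] [Module k M] (f : Coeffs k) (q : ℕ → M)
    (hq : ∑ i : Fin (f.d + 1), f.α i • q i = 0) (j : Fin f.d) :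
    ∑ i : Fin f.d, companion f i j • q i = q (j + 1) := by
  by_cases hj : (j : ℕ) + 1 = f.d
  · rw [Fin.sum_univ_castSucc] at hq
    have h1 : ∀ i : Fin f.d, companion f i j • q i
        = -((f.α (Fin.last f.d))⁻¹ • f.α i.castSucc • q i) := by
      intro i
      rw [companion, Matrix.of_apply, if_pos hj, smul_smul, ← neg_smul, div_eq_inv_mul,
        mul_neg]
    simp only [Fin.val_castSucc, Fin.val_last] at hq
    rw [Finset.sum_congr rfl fun i _ => h1 i, Finset.sum_neg_distrib, ← Finset.smul_sum,
      eq_neg_of_add_eq_zero_left hq, smul_neg, neg_neg, smul_smul, inv_mul_cancel₀ f.last_ne,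
      one_smul, hj]
  · rw [Finset.sum_eq_single ⟨j + 1, by omega⟩]
    · simp [companion, hj]
    · intro b _ hb
      have : (b : ℕ) ≠ j + 1 := fun h => hb (Fin.ext h)
      simp [companion, hj, this]
    · simp

/-- The first basis vector (zero if `d = 0`). -/
def Model.gen (f : Coeffs k) : Model τ f := fun i : Fin f.d => if (i : ℕ) = 0 then 1 else 0

/-- All columns of F_f but the last are unit vectors, and τ fixes 0 and 1, so x shifts the standard
basis until its last member is reached. -/
theorem Model.xpow_gen (f : Coeffs k) (n : ℕ) (hn : n < f.d) :
    SkewLaurent.monomial τ (n : ℤ) 1 • Model.gen τ f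
      = (Pi.single (⟨n, hn⟩ : Fin f.d) 1 : Fin f.d → k) := by
  induction n with
  | zero =>
    rw [Nat.cast_zero, SkewLaurent.monomial_zero_one, one_smul]
    funext i
    simp [Model.gen, Pi.single_apply, Fin.ext_iff]
  | succ n ih =>
    have h := SkewLaurent.x_mul_monomial τ (n : ℤ) 1
    rw [map_one] at h
    rw [Nat.cast_succ, ← h, mul_smul, ih (by omega), Model.x_smul]
    have h1 : τ ∘ (Pi.single (⟨n, by omega⟩ : Fin f.d) 1 : Fin f.d → k)
        = (Pi.single (⟨n, by omega⟩ : Fin f.d) 1 : Fin f.d → k) := by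
      funext i
      by_cases hi : i = ⟨n, by omega⟩
      · subst hi; simp
      · simp [hi]
    have h2 : n + 1 ≠ f.d := by omega
    rw [h1, Matrix.mulVec_single_one]
    funext i
    simp [companion, h2, Pi.single_apply, Fin.ext_iff]

/-- The last column of F_f is x^d applied to the generator, and it was chosen to make this relation
hold. -/
theorem Model.poly_smul_gen (f : Coeffs k) : f.toSkew τ • Model.gen τ f = 0 := by
  have h1 : ∀ (n : ℕ) (a : k), SkewLaurent.monomial τ (n : ℤ) a • Model.gen τ f
      = a • SkewLaurent.monomial τ (n : ℤ) 1 • Model.gen τ f := by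
    intro n a
    rw [← Model.C_smul, ← mul_smul, SkewLaurent.C_mul_monomial, mul_one]
  rw [Coeffs.toSkew, Finset.sum_smul, Fin.sum_univ_castSucc]
  rcases Nat.eq_zero_or_pos f.d with h0 | h0
  · funext i
    exact absurd i.2 (by omega)
  · have hlast : SkewLaurent.monomial τ ((f.d : ℕ) : ℤ) 1 • Model.gen τ f
        = fun i : Fin f.d => -f.α i.castSucc / f.α (Fin.last f.d) := by
      have h := SkewLaurent.x_mul_monomial τ ((f.d - 1 : ℕ) : ℤ) 1
      rw [map_one] at h
      have h2 : ((f.d : ℕ) : ℤ) = ((f.d - 1 : ℕ) : ℤ) + 1 := by omega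
      rw [h2, ← h, mul_smul, Model.xpow_gen τ f (f.d - 1) (by omega), Model.x_smul]
      have h1 : τ ∘ (Pi.single (⟨f.d - 1, by omega⟩ : Fin f.d) 1 : Fin f.d → k)
          = (Pi.single (⟨f.d - 1, by omega⟩ : Fin f.d) 1 : Fin f.d → k) := by
        funext i
        by_cases hi : i = ⟨f.d - 1, by omega⟩
        · subst hi; simp
        · simp [hi]
      have h2 : f.d - 1 + 1 = f.d := by omega
      rw [h1, Matrix.mulVec_single_one]
      funext i
      simp [companion, h2]
    have h3 : ∀ i : Fin f.d, SkewLaurent.monomial τ ((i.castSucc : Fin (f.d + 1)) : ℕ)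
        (f.α i.castSucc) • Model.gen τ f
        = (Pi.single i (f.α i.castSucc) : Fin f.d → k) := by
      intro i
      rw [h1, Fin.val_castSucc, Model.xpow_gen τ f i i.2]
      refine (Pi.single_smul' i (f.α i.castSucc) (1 : k)).symm.trans ?_
      simp
    rw [Finset.sum_congr rfl fun i _ => h3 i, h1, Fin.val_last, hlast]
    refine (congrArg (fun u : Fin f.d → k => u + _)
      (Finset.univ_sum_single fun i : Fin f.d => f.α i.castSucc)).trans ?_
    funext i
    have := f.last_ne
    change f.α i.castSucc + f.α (Fin.last f.d) * (-f.α i.castSucc / f.α (Fin.last f.d)) = 0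
    field_simp
    ring

/-- The map `P/Pf → k^d` with `1 ↦ e₀`. -/
def Model.ofQuot (f : Coeffs k) : quotLeft (f.toSkew τ) →ₗ[SkewLaurent τ] Model τ f :=
  Submodule.liftQ _ (LinearMap.toSpanSingleton (SkewLaurent τ) (Model τ f) (Model.gen τ f)) (by
    rw [Submodule.span_le, Set.singleton_subset_iff]
    exact Model.poly_smul_gen τ f)

theorem Model.ofQuot_mk (f : Coeffs k) (p : SkewLaurent τ) :
    Model.ofQuot τ f (Submodule.Quotient.mk p) = p • Model.gen τ f := rfl

/-- The class of `1` in `P/Pf`. -/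
abbrev quotOne (f : Coeffs k) : quotLeft (f.toSkew τ) := Submodule.Quotient.mk 1

theorem poly_smul_quotOne (f : Coeffs k) : f.toSkew τ • quotOne τ f = 0 := by
  rw [quotOne, ← Submodule.Quotient.mk_smul, smul_eq_mul, mul_one, Submodule.Quotient.mk_eq_zero]
  exact Submodule.mem_span_singleton_self _

/-- The map `k^d → P/Pf` with `e_i ↦ x^i`. -/
def Model.toQuot (f : Coeffs k) : Model τ f →ₗ[SkewLaurent τ] quotLeft (f.toSkew τ) where
  toFun v := ∑ i : Fin f.d, SkewLaurent.monomial τ (i : ℕ) (v i) • quotOne τ f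
  map_add' v w := by
    rw [← Finset.sum_add_distrib]
    refine Finset.sum_congr rfl fun i _ => ?_
    rw [← add_smul]
    congr 1
    exact SkewMonoidAlgebra.single_add _ _ _
  map_smul' := by
    let φ : Model τ f →+ quotLeft (f.toSkew τ) :=
      AddMonoidHom.mk' (fun v => ∑ i : Fin f.d, SkewLaurent.monomial τ (i : ℕ) (v i) • quotOne τ f)
        (fun v w => by
          rw [← Finset.sum_add_distrib]
          refine Finset.sum_congr rfl fun i _ => ?_
          rw [← add_smul]
          congr 1
          exact SkewMonoidAlgebra.single_add _ _ _)
    refine SkewLaurent.map_smul_of_C_x τ φ ?_ ?_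
    · intro a v
      change ∑ i : Fin f.d, _ = SkewLaurent.C τ a • ∑ i : Fin f.d, _
      rw [Finset.smul_sum]
      refine Finset.sum_congr rfl fun i _ => ?_
      rw [← mul_smul, SkewLaurent.C_mul_monomial, Model.C_smul]
      rfl
    · intro v
      -- The quotient is viewed as a vector space over k so that `sum_companion_smul` applies to the
      -- sequence of classes of the powers of x.
      let _ : Module k (quotLeft (f.toSkew τ)) :=
        Module.compHom (quotLeft (f.toSkew τ)) (SkewLaurent.C τ)
      have hs : ∀ (n : ℤ) (a : k), SkewLaurent.monomial τ n a • quotOne τ f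
          = a • SkewLaurent.monomial τ n 1 • quotOne τ f := by
        intro n a
        change _ = SkewLaurent.C τ a • (SkewLaurent.monomial τ n 1 • quotOne τ f)
        rw [← mul_smul, SkewLaurent.C_mul_monomial, mul_one]
      have hrel : ∑ i : Fin (f.d + 1), f.α i • SkewLaurent.monomial τ (i : ℕ) 1 • quotOne τ f
          = 0 := by
        refine Eq.trans ?_ (poly_smul_quotOne τ f)
        refine Eq.trans ?_ Finset.sum_smul.symm
        exact Finset.sum_congr rfl fun i _ => (hs _ _).symm
      change ∑ i : Fin f.d, _ = SkewLaurent.monomial τ 1 1 • ∑ i : Fin f.d, _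
      rw [Model.x_smul, Finset.smul_sum]
      have h1 : ∀ j : Fin f.d, SkewLaurent.monomial τ 1 1 •
          SkewLaurent.monomial τ (j : ℕ) (v j) • quotOne τ f
          = ∑ i : Fin f.d, (τ (v j) * companion f i j) •
            SkewLaurent.monomial τ (i : ℕ) 1 • quotOne τ f := by
        intro j
        rw [← mul_smul, SkewLaurent.x_mul_monomial, hs]
        simp only [mul_smul]
        rw [← Finset.smul_sum]
        congr 1
        exact_mod_cast (sum_companion_smul f
          (fun i => SkewLaurent.monomial τ (i : ℕ) 1 • quotOne τ f) hrel j).symm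
      rw [Finset.sum_congr rfl fun j _ => h1 j, Finset.sum_comm]
      refine Finset.sum_congr rfl fun i _ => ?_
      rw [hs, ← Finset.sum_smul]
      congr 1
      rw [Matrix.mulVec, dotProduct]
      exact Finset.sum_congr rfl fun j _ => mul_comm (companion f i j) (τ (v j))

theorem Model.toQuot_apply (f : Coeffs k) (v : Model τ f) : Model.toQuot τ f v
    = ∑ i : Fin f.d, SkewLaurent.monomial τ (i : ℕ) (v i) • quotOne τ f := rfl

theorem Model.toQuot_gen (f : Coeffs k) : Model.toQuot τ f (Model.gen τ f) = quotOne τ f := by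
  rw [Model.toQuot_apply]
  rcases Nat.eq_zero_or_pos f.d with h0 | h0
  -- For d = 0 the generator is the zero vector, so the class of 1 must vanish; it does, since f is
  -- then a nonzero constant, hence a unit.
  · have h1 : f.toSkew τ = SkewLaurent.C τ (f.α 0) := by
      rw [Coeffs.toSkew, Fin.sum_univ_succ]
      have : IsEmpty (Fin f.d) := by rw [h0]; infer_instance
      rw [Fintype.sum_empty, add_zero]
      rfl
    have h2 : quotOne τ f = SkewLaurent.C τ (f.α 0)⁻¹ • f.toSkew τ • quotOne τ f := by
      have h3 : SkewLaurent.C τ (f.α 0)⁻¹ * f.toSkew τ = 1 := by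
        rw [h1, ← map_mul, inv_mul_cancel₀ f.zero_ne, map_one]
      rw [← mul_smul, h3, one_smul]
    rw [poly_smul_quotOne, smul_zero] at h2
    rw [h2]
    have : IsEmpty (Fin f.d) := by rw [h0]; infer_instance
    rw [Fintype.sum_empty]
  · rw [Finset.sum_eq_single ⟨0, h0⟩]
    · change SkewLaurent.monomial τ ((0 : ℕ) : ℤ) (if (0 : ℕ) = 0 then 1 else 0) • quotOne τ f = _
      rw [if_pos rfl, Nat.cast_zero, SkewLaurent.monomial_zero_one, one_smul]
    · intro b _ hb
      have : (b : ℕ) ≠ 0 := fun h => hb (Fin.ext h)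
      have h1 : Model.gen τ f b = 0 := if_neg this
      rw [h1]
      have h2 : SkewLaurent.monomial τ (b : ℕ) (0 : k) = 0 := SkewMonoidAlgebra.single_zero _
      rw [h2, zero_smul]
    · simp

/-- `P/Pf` in coordinates. -/
def Model.equivQuot (f : Coeffs k) : quotLeft (f.toSkew τ) ≃ₗ[SkewLaurent τ] Model τ f :=
  LinearEquiv.ofLinearMap (Model.ofQuot τ f) (Model.toQuot τ f)
    (by
      refine LinearMap.ext fun v => ?_
      rw [LinearMap.comp_apply, Model.toQuot_apply, map_sum, LinearMap.id_apply]
      refine Eq.trans ?_ (Finset.univ_sum_single (v : Fin f.d → k))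
      refine Finset.sum_congr rfl fun i _ => ?_
      rw [map_smul, Model.ofQuot_mk, one_smul]
      have : SkewLaurent.monomial τ (i : ℕ) (v i)
          = SkewLaurent.C τ (v i) * SkewLaurent.monomial τ (i : ℕ) 1 := by
        rw [SkewLaurent.C_mul_monomial, mul_one]
      rw [this, mul_smul, Model.xpow_gen τ f i i.2, Model.C_smul]
      refine (Pi.single_smul' i (v i) (1 : k)).symm.trans ?_
      simp)
    (by
      refine LinearMap.ext fun q => ?_
      obtain ⟨p, rfl⟩ := Submodule.Quotient.mk_surjective _ q
      rw [LinearMap.comp_apply, Model.ofQuot_mk, map_smul, Model.toQuot_gen, LinearMap.id_apply,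
        quotOne, ← Submodule.Quotient.mk_smul, smul_eq_mul, mul_one])

/-- The matrices of homomorphisms `P/Pf → P/Pg`. -/
def Intertwines (f g : Coeffs k) (G : Matrix (Fin g.d) (Fin f.d) k) : Prop :=
  G * companion f = companion g * G.map τ

variable {τ}

/-- The homomorphism with a given matrix. -/
def Model.hom {f g : Coeffs k} {G : Matrix (Fin g.d) (Fin f.d) k} (hG : Intertwines τ f g G) :
    Model τ f →ₗ[SkewLaurent τ] Model τ g where
  toFun v := G.mulVec v
  map_add' v w := Matrix.mulVec_add G v w
  map_smul' := by
    refine SkewLaurent.map_smul_of_C_x τ (G.mulVecLin.toAddMonoidHom :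
      (Fin f.d → k) →+ (Fin g.d → k)) ?_ ?_
    · intro a v
      refine (congrArg _ (Model.C_smul τ f a v)).trans ?_
      refine Eq.trans ?_ (Model.C_smul τ g a _).symm
      exact G.mulVec_smul a v
    · intro v
      refine (congrArg _ (Model.x_smul τ f v)).trans ?_
      refine Eq.trans ?_ (Model.x_smul τ g _).symm
      change G.mulVec ((companion f).mulVec (τ ∘ v)) = (companion g).mulVec (τ ∘ G.mulVec v)
      have h := map_comp_mulVec (τ : k →+* k) G v
      simp only [RingHom.coe_coe] at h
      rw [h, Matrix.mulVec_mulVec, Matrix.mulVec_mulVec, hG]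

/-- Such a map is linear over k and therefore has a matrix. Its commutation with x, tested on basis
vectors, which τ fixes, is the intertwining relation column by column. -/
theorem Model.exists_hom_eq {f g : Coeffs k} (φ : Model τ f →ₗ[SkewLaurent τ] Model τ g) :
    ∃ (G : Matrix (Fin g.d) (Fin f.d) k) (hG : Intertwines τ f g G), φ = Model.hom hG := by
  let ψ : (Fin f.d → k) →ₗ[k] (Fin g.d → k) :=
    { toFun := φ
      map_add' := map_add φ
      map_smul' := fun a v => by
        refine (congrArg φ (Model.C_smul τ f a v).symm).trans ?_
        rw [map_smul, Model.C_smul]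
        rfl }
  have h1 : ∀ v, φ v = (LinearMap.toMatrix' ψ).mulVec v :=
    fun v => (LinearMap.toMatrix'_mulVec ψ v).symm
  have hG : Intertwines τ f g (LinearMap.toMatrix' ψ) := by
    refine Matrix.ext_of_mulVec_single fun j => ?_
    have h2 : τ ∘ (Pi.single j 1 : Fin f.d → k) = (Pi.single j 1 : Fin f.d → k) := by
      funext i
      by_cases hi : i = j
      · subst hi; simp
      · simp [hi]
    have h := φ.map_smul (SkewLaurent.monomial τ 1 1) (Pi.single j 1 : Fin f.d → k)
    rw [Model.x_smul, Model.x_smul, h1, h1] at h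
    have h3 := map_comp_mulVec (τ : k →+* k) (LinearMap.toMatrix' ψ) (Pi.single j 1)
    simp only [RingHom.coe_coe] at h3
    rw [h3, h2, Matrix.mulVec_mulVec, Matrix.mulVec_mulVec] at h
    exact h
  exact ⟨_, hG, LinearMap.ext h1⟩

theorem Model.hom_injective {f g : Coeffs k} {G H : Matrix (Fin g.d) (Fin f.d) k}
    (hG : Intertwines τ f g G) (hH : Intertwines τ f g H) (h : Model.hom hG = Model.hom hH) :
    G = H :=
  Matrix.ext_of_mulVec_single fun j =>
    congrArg (fun φ : Model τ f →ₗ[SkewLaurent τ] Model τ g => φ (Pi.single j 1 : Fin f.d → k)) h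

theorem isSimilar_toSkew_iff {f g : Coeffs k} : IsSimilar (f.toSkew τ) (g.toSkew τ) ↔
    ∃ (G : Matrix (Fin g.d) (Fin f.d) k) (H : Matrix (Fin f.d) (Fin g.d) k),
      Intertwines τ f g G ∧ G * H = 1 ∧ H * G = 1 := by
  constructor
  · rintro ⟨e⟩
    let e' : Model τ f ≃ₗ[SkewLaurent τ] Model τ g :=
      (Model.equivQuot τ f).symm.trans (e.trans (Model.equivQuot τ g))
    obtain ⟨G, hG, h1⟩ := Model.exists_hom_eq e'.toLinearMap
    obtain ⟨H, hH, h2⟩ := Model.exists_hom_eq e'.symm.toLinearMap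
    have h1' : ∀ v, e' v = G.mulVec v := fun v => congrArg (fun φ : Model τ f →ₗ[SkewLaurent τ]
      Model τ g => φ v) h1
    have h2' : ∀ v, e'.symm v = H.mulVec v := fun v => congrArg (fun φ :
      Model τ g →ₗ[SkewLaurent τ] Model τ f => φ v) h2
    refine ⟨G, H, hG, ?_, ?_⟩
    · refine Matrix.ext_of_mulVec_single fun j => ?_
      rw [← Matrix.mulVec_mulVec, Matrix.one_mulVec, ← h2', ← h1']
      exact e'.apply_symm_apply _
    · refine Matrix.ext_of_mulVec_single fun j => ?_
      rw [← Matrix.mulVec_mulVec, Matrix.one_mulVec, ← h1', ← h2']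
      exact e'.symm_apply_apply _
  · rintro ⟨G, H, hG, hGH, hHG⟩
    have hb : Function.Bijective (Model.hom hG) := by
      refine Function.bijective_iff_has_inverse.mpr ⟨fun v => H.mulVec v, fun v => ?_, fun v => ?_⟩
      · change H.mulVec (G.mulVec v) = v
        rw [Matrix.mulVec_mulVec, hHG, Matrix.one_mulVec]
      · change G.mulVec (H.mulVec v) = v
        rw [Matrix.mulVec_mulVec, hGH, Matrix.one_mulVec]
    exact ⟨(Model.equivQuot τ f).trans ((LinearEquiv.ofBijective _ hb).trans
      (Model.equivQuot τ g).symm)⟩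

/-- Complementary pairs correspond to projections: an idempotent has complementary range and kernel,
and a complementary pair is the range and kernel of the projection onto its first member. -/
theorem forall_isCompl_iff_idempotent {P M : Type*} [Ring P] [AddCommGroup M] [Module P M] :
    (∀ U W : Submodule P M, IsCompl U W → U = ⊥ ∨ W = ⊥) ↔
      ∀ e : Module.End P M, e * e = e → e = 0 ∨ e = 1 := by
  constructor
  · intro h e he
    rcases h _ _ (LinearMap.IsIdempotentElem.isCompl (f := e) he) with h1 | h1
    · exact Or.inl (LinearMap.range_eq_bot.mp h1)
    · refine Or.inr (LinearMap.ext fun v => ?_)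
      refine LinearMap.ker_eq_bot.mp h1 ?_
      exact congrArg (fun φ : Module.End P M => φ v) he
  · intro h U W hUW
    rcases h _ (Submodule.isIdempotentElem_projection hUW) with h1 | h1
    · left
      rw [← Submodule.range_projection hUW, h1, LinearMap.range_zero]
    · right
      rw [← Submodule.ker_projection hUW, h1]
      exact LinearMap.ker_id

/-- Direct decompositions are idempotent endomorphisms, and endomorphisms of P/Pf are
self-intertwining matrices. The condition d > 0 expresses that the quotient is nonzero. -/
theorem isIndecomposable_toSkew_iff {f : Coeffs k} : IsIndecomposable (f.toSkew τ) ↔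
    0 < f.d ∧ ∀ E : Matrix (Fin f.d) (Fin f.d) k,
      Intertwines τ f f E → E * E = E → E = 0 ∨ E = 1 := by
  have hd : Nontrivial (quotLeft (f.toSkew τ)) ↔ 0 < f.d := by
    rw [(Model.equivQuot τ f).toEquiv.nontrivial_congr]
    constructor
    · intro h
      by_contra h0
      have : IsEmpty (Fin f.d) := by
        rw [Nat.eq_zero_of_not_pos h0]; infer_instance
      exact not_subsingleton (Model τ f) inferInstance
    · intro h
      have : Nonempty (Fin f.d) := ⟨⟨0, h⟩⟩
      exact inferInstanceAs (Nontrivial (Fin f.d → k))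
  rw [IsIndecomposable, hd, forall_isCompl_iff_idempotent]
  refine and_congr_right fun _ => ?_
  have hzero : Intertwines τ f f 0 := by simp [Intertwines]
  have hone : Intertwines τ f f 1 := by simp [Intertwines]
  let c := (Model.equivQuot τ f).conjRingEquiv
  constructor
  · intro h E hE hEE
    have h1 : Model.hom hE * Model.hom hE = Model.hom hE := by
      refine LinearMap.ext fun v => ?_
      change E.mulVec (E.mulVec v) = E.mulVec v
      rw [Matrix.mulVec_mulVec, hEE]
    rcases h (c.symm (Model.hom hE)) (by rw [← map_mul, h1]) with h2 | h2
    · left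
      rw [EmbeddingLike.map_eq_zero_iff] at h2
      exact Model.hom_injective hE hzero (h2.trans
        (LinearMap.ext fun v => (Matrix.zero_mulVec (v : Fin f.d → k)).symm))
    · right
      rw [EmbeddingLike.map_eq_one_iff] at h2
      exact Model.hom_injective hE hone (h2.trans
        (LinearMap.ext fun v => (Matrix.one_mulVec (v : Fin f.d → k)).symm))
  · intro h e he
    obtain ⟨E, hE, h1⟩ := Model.exists_hom_eq (c e)
    have h2 : E * E = E := by
      have h3 : c e * c e = c e := by rw [← map_mul, he]
      rw [h1] at h3
      refine Matrix.ext_of_mulVec_single fun j => ?_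
      rw [← Matrix.mulVec_mulVec]
      exact congrArg (fun φ : Module.End (SkewLaurent τ) (Model τ f) =>
        φ (Pi.single j 1 : Fin f.d → k)) h3
    rcases h E hE h2 with h3 | h3
    · left
      refine (EmbeddingLike.map_eq_zero_iff (f := c)).mp (h1.trans ?_)
      subst h3
      exact LinearMap.ext fun v => Matrix.zero_mulVec (v : Fin f.d → k)
    · right
      refine (EmbeddingLike.map_eq_one_iff (f := c)).mp (h1.trans ?_)
      subst h3
      exact LinearMap.ext fun v => Matrix.one_mulVec (v : Fin f.d → k)

end skewModel

/-! ### The triangular matrix behind f♯, and the indecomposability of f♯. -/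

section sharpPoly

/-- The rows of a companion matrix: `F_f = (shift) - (last column)`. -/
theorem sum_map_companion_mul {k l : Type*} [Field k] [Field l] (f : Coeffs k) (c : k →+* l)
    (h : ℕ → l) (j : Fin f.d) :
    ∑ i : Fin f.d, c (companion f j i) * h i = (if (j : ℕ) = 0 then 0 else h (j - 1))
      - c (f.α j.castSucc / f.α (Fin.last f.d)) * h (f.d - 1) := by
  have hj := j.2
  have h1 : ∀ i : Fin f.d, c (companion f j i) * h i
      = (if (j : ℕ) = i + 1 then h i else 0)
        - (if (i : ℕ) + 1 = f.d then c (f.α j.castSucc / f.α (Fin.last f.d)) * h i else 0) := by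
    intro i
    rw [companion, Matrix.of_apply]
    by_cases hi : (i : ℕ) + 1 = f.d
    · have : (j : ℕ) ≠ i + 1 := by omega
      rw [if_pos hi, if_neg this, if_pos hi, neg_div, map_neg, zero_sub, neg_mul]
    · rw [if_neg hi, if_neg hi, sub_zero]
      split_ifs <;> simp
  rw [Finset.sum_congr rfl fun i _ => h1 i, Finset.sum_sub_distrib]
  congr 1
  · split_ifs with h0
    · refine Finset.sum_eq_zero fun i _ => if_neg (by omega)
    · rw [Finset.sum_eq_single ⟨j - 1, by omega⟩]
      · exact if_pos (show (j : ℕ) = j - 1 + 1 by omega)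
      · intro b _ hb
        exact if_neg fun hc => hb (Fin.ext (show (b : ℕ) = j - 1 by omega))
      · simp
  · rw [Finset.sum_eq_single ⟨f.d - 1, by omega⟩]
    · exact if_pos (show f.d - 1 + 1 = f.d by omega)
    · intro b _ hb
      exact if_neg fun hc => hb (Fin.ext (show (b : ℕ) = f.d - 1 by omega))
    · simp

variable {R : Type u} [CommRing R] (D : Datum R) (m : MaximalSpectrum R)

theorem up_mk (e : R ≃+* R) {n n' : MaximalSpectrum R} (h : maxPerm e n = n') (r : R) :
    up e h (Ideal.Quotient.mk n.asIdeal r) = Ideal.Quotient.mk n'.asIdeal (e r) := rfl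

theorem tau_mk (r : R) : tau D m (Ideal.Quotient.mk m.asIdeal r)
    = Ideal.Quotient.mk m.asIdeal (((D.sigma : RingAut R) ^ Nat.card (orbit D m)) r) := rfl

theorem sigma_pow_star (i : ℕ) (r : R) : ((D.sigma : RingAut R) ^ i) (D.star r)
    = D.star (((D.sigma : RingAut R) ^ i) r) := by
  induction i with
  | zero => rfl
  | succ i ih =>
    rw [pow_succ', RingAut.mul_apply, ih, RingAut.mul_apply]
    exact D.sigma_star _

variable (hreal : IsReal D m)

theorem tau_conj (a : K m) : tau D m (conj D m hreal a) = conj D m hreal (tau D m a) := by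
  obtain ⟨r, rfl⟩ := Ideal.Quotient.mk_surjective a
  rw [tau_mk, conj, up_mk]
  erw [tau_mk]
  rw [sigma_pow_star, up_mk]

theorem conj_conj (a : K m) : conj D m hreal (conj D m hreal a) = a := by
  obtain ⟨r, rfl⟩ := Ideal.Quotient.mk_surjective a
  rw [conj, up_mk]
  erw [up_mk]
  rw [D.star_star]

theorem xiNum_succ (j : ℕ) : xiNum D m (j + 1) = xi D m * tau D m (xiNum D m j) := by
  rw [xiNum, xiNum, Finset.prod_range_succ', map_prod, mul_comm, pow_zero, RingAut.one_apply]
  congr 1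
  exact Finset.prod_congr rfl fun i _ => by rw [pow_succ', RingAut.mul_apply]

variable (hnb : NoBreaks D m) (f : Coeffs (K m))

/-- The coefficients of a polynomial, extended by zero. -/
def Coeffs.ext {k : Type*} [Zero k] (f : Coeffs k) (i : ℕ) : k :=
  if h : i < f.d + 1 then f.α ⟨i, h⟩ else 0

/-- The entry `{i}_ξ τ^i(conj α_{j-i})` of the matrix that compares `V(ω, f)^♯` with
`V(ω, f^♯)`. -/
def sharpEntry (i j : ℕ) : K m :=
  if i ≤ j then xiNum D m i * (tau D m ^ i) (conj D m hreal (f.ext (j - i))) else 0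

/-- Since {i+1}_ξ = ξ τ({i}_ξ) and an entry otherwise depends on τ^i and j - i, the operation ξτ
moves the array one step down its diagonals. -/
theorem xi_mul_tau_sharpEntry (i j : ℕ) :
    xi D m * tau D m (sharpEntry D m hreal f i j) = sharpEntry D m hreal f (i + 1) (j + 1) := by
  unfold sharpEntry
  by_cases h : i ≤ j
  · rw [if_pos h, if_pos (by omega), map_mul, ← mul_assoc, ← xiNum_succ, pow_succ',
      RingAut.mul_apply, Nat.add_sub_add_right]
  · rw [if_neg h, if_neg (by omega), map_zero, mul_zero]

/-- The column with index d, just outside the d × d matrix, consists of the coefficients of f♯; this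
is how the last column of its companion matrix enters the computation. -/
theorem sharpEntry_last (i : Fin (f.d + 1)) :
    sharpEntry D m hreal f i f.d = (sharp D m hreal hnb f).α i := by
  unfold sharpEntry
  rw [if_pos (by omega), Coeffs.ext, dif_pos (by omega)]
  change _ = xiNum D m i * (tau D m ^ (i : ℕ)) (conj D m hreal (f.α i.rev))
  congr 4
  exact Fin.ext (by simp [Fin.rev])

/-- The upper triangular matrix that compares `V(ω, f)^♯` with `V(ω, f^♯)`. -/
def sharpMat : Matrix (Fin (sharp D m hreal hnb f).d) (Fin f.d) (K m) :=
  Matrix.of fun i j => sharpEntry D m hreal f i j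

theorem exists_inv_of_triangular {k : Type*} [Field k] {d : ℕ} (A : Matrix (Fin d) (Fin d) k)
    (h0 : ∀ i j, j < i → A i j = 0) (h1 : ∀ i, A i i ≠ 0) :
    ∃ B : Matrix (Fin d) (Fin d) k, A * B = 1 ∧ B * A = 1 := by
  have hdet : IsUnit A.det := by
    rw [Matrix.det_of_isUpperTriangular (fun i j hij => h0 i j hij)]
    exact (Finset.prod_ne_zero_iff.mpr fun i _ => h1 i).isUnit
  exact ⟨A⁻¹, Matrix.mul_nonsing_inv _ hdet, Matrix.nonsing_inv_mul _ hdet⟩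

theorem exists_sharpMat_inv : ∃ N : Matrix (Fin f.d) (Fin (sharp D m hreal hnb f).d) (K m),
    sharpMat D m hreal hnb f * N = (1 : Matrix (Fin (sharp D m hreal hnb f).d) _ (K m)) ∧
      N * sharpMat D m hreal hnb f = (1 : Matrix (Fin f.d) (Fin f.d) (K m)) := by
  refine exists_inv_of_triangular (d := f.d) (sharpMat D m hreal hnb f) ?_ ?_
  · intro i j hij
    exact if_neg (not_le.mpr hij)
  · intro i
    refine (if_pos le_rfl).trans_ne (mul_ne_zero (xiNum_ne_zero D m hnb _)
      ((map_ne_zero_iff _ (RingEquiv.injective _)).mpr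
        ((map_ne_zero_iff _ (conj D m hreal).injective).mpr ?_)))
    rw [Nat.sub_self, Coeffs.ext, dif_pos (by omega)]
    exact f.zero_ne

/-- Both companion matrices act as a shift minus a rank-one correction. On the left, ξτ shifts L
along its diagonals and the correction from F_{f♯} clears the last column below row 0, leaving row 0
zero except for its last entry. On the right, the conjugate transpose of F_f shifts the columns
back, and its correction rebuilds row 0 from that single entry. -/
theorem companion_sharp : xi D m • (companion (sharp D m hreal hnb f) *
      (sharpMat D m hreal hnb f).map (tau D m) * ((companion f).map (conj D m hreal))ᵀ)
    = sharpMat D m hreal hnb f := by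
  have hd : (sharp D m hreal hnb f).d = f.d := rfl
  -- the entries of `ξ F_g τ(L)`
  let b : ℕ → ℕ → K m := fun i j => if i = 0 then (if j + 1 = f.d then -sharpEntry D m hreal f 0 f.d
    else 0) else (if j + 1 = f.d then 0 else sharpEntry D m hreal f i (j + 1))
  have hB : ∀ (i : Fin (sharp D m hreal hnb f).d) (j : Fin f.d),
      xi D m * (companion (sharp D m hreal hnb f) *
        (sharpMat D m hreal hnb f).map (tau D m)) i j = b i j := by
    intro i j
    have hi : (i : ℕ) < f.d := i.2
    have h1 := sum_map_companion_mul (sharp D m hreal hnb f) (RingHom.id _)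
      (fun l => tau D m (sharpEntry D m hreal f l j)) i
    have h2 : (companion (sharp D m hreal hnb f) *
        (sharpMat D m hreal hnb f).map (tau D m)) i j = _ := h1
    rw [h2, mul_sub]
    change _ - xi D m * (_ * tau D m (sharpEntry D m hreal f (f.d - 1) j)) = _
    -- The shift moves row d - 1 to row d, where by triangularity only column d, coming from j = d -
    -- 1, survives.
    have hlast : xi D m * tau D m (sharpEntry D m hreal f (f.d - 1) j)
        = if (j : ℕ) + 1 = f.d then (sharp D m hreal hnb f).α (Fin.last _) else 0 := by
      rw [xi_mul_tau_sharpEntry]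
      split_ifs with hj
      · rw [hj, Nat.sub_add_cancel (by omega)]
        exact sharpEntry_last D m hreal hnb f (Fin.last _)
      · exact if_neg (by omega)
    rw [RingHom.id_apply, mul_left_comm, hlast]
    have hne := (sharp D m hreal hnb f).last_ne
    have hα : (sharp D m hreal hnb f).α i.castSucc = sharpEntry D m hreal f i f.d :=
      (sharpEntry_last D m hreal hnb f i.castSucc).symm
    have h3 : xi D m * (if (i : ℕ) = 0 then 0 else tau D m (sharpEntry D m hreal f (i - 1) j))
        = if (i : ℕ) = 0 then 0 else sharpEntry D m hreal f i (j + 1) := by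
      split_ifs with h0
      · rw [mul_zero]
      · rw [xi_mul_tau_sharpEntry, Nat.sub_add_cancel (by omega)]
    rw [h3, hα]
    change _ = if (i : ℕ) = 0 then _ else _
    by_cases hj : (j : ℕ) + 1 = f.d
    · rw [if_pos hj, if_pos hj, if_pos hj, div_mul_cancel₀ _ hne, hj]
      split_ifs with h0
      · rw [h0, zero_sub]
      · rw [sub_self]
    · rw [if_neg hj, if_neg hj, if_neg hj, mul_zero, sub_zero]
  ext i j
  rw [Matrix.smul_apply, smul_eq_mul, Matrix.mul_apply, Finset.mul_sum]
  have h1 := sum_map_companion_mul f (conj D m hreal) (fun l => b i l) j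
  have h2 : ∀ l : Fin f.d, xi D m * ((companion (sharp D m hreal hnb f) *
        (sharpMat D m hreal hnb f).map (tau D m)) i l * ((companion f).map (conj D m hreal))ᵀ l j)
      = conj D m hreal (companion f j l) * b i l := by
    intro l
    rw [← mul_assoc, hB, mul_comm]
    rfl
  rw [Finset.sum_congr rfl fun l _ => h2 l, h1]
  have hne := (map_ne_zero_iff _ (conj D m hreal).injective).mpr f.last_ne
  have hj := j.2
  have hs0 : ∀ j' : ℕ, ∀ h : j' < f.d + 1, sharpEntry D m hreal f 0 j'
      = conj D m hreal (f.α ⟨j', h⟩) := by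
    intro j' h
    rw [sharpEntry, if_pos (Nat.zero_le _), Nat.sub_zero, Coeffs.ext, dif_pos h, xiNum,
      Finset.prod_range_zero, one_mul, pow_zero, RingAut.one_apply]
  change _ = sharpEntry D m hreal f i j
  change (if (j : ℕ) = 0 then 0 else (if (i : ℕ) = 0 then _ else _)) -
    _ * (if (i : ℕ) = 0 then _ else _) = _
  rw [if_pos (show f.d - 1 + 1 = f.d by omega), if_pos (show f.d - 1 + 1 = f.d by omega)]
  -- Row 0 comes entirely from the correction term, through -(conj α_j / conj α_d) · (-conj α_d) =
  -- conj α_j. In the other rows the correction vanishes and only the shift remains.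
  by_cases h0 : (i : ℕ) = 0
  · rw [if_pos h0, if_pos h0, h0,
      show (if (j : ℕ) = 0 then 0 else if (j : ℕ) - 1 + 1 = f.d then
        -sharpEntry D m hreal f 0 f.d else 0) = 0 by split_ifs <;> first | rfl | omega,
      zero_sub, mul_neg, neg_neg, hs0 f.d (by omega), hs0 j (by omega), map_div₀]
    exact div_mul_cancel₀ _ hne
  · rw [if_neg h0, if_neg h0, mul_zero, sub_zero]
    split_ifs with h2 h3
    · rw [h2]
      exact (if_neg (by omega)).symm
    · omega
    · rw [Nat.sub_add_cancel (by omega)]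

theorem map_map_conj {ι κ : Type*} (A : Matrix ι κ (K m)) :
    (A.map (conj D m hreal)).map (conj D m hreal) = A :=
  Matrix.ext fun i j => conj_conj D m hreal (A i j)

theorem map_tau_map_conj {ι κ : Type*} (A : Matrix ι κ (K m)) :
    (A.map (tau D m)).map (conj D m hreal) = (A.map (conj D m hreal)).map (tau D m) :=
  Matrix.ext fun i j => (tau_conj D m hreal (A i j)).symm

/-- An idempotent E for f♯ is conjugated by L, and the conjugate transpose of the result is an
idempotent for f by `companion_sharp`. This correspondence preserves and reflects 0 and 1. -/
theorem isIndecomposable_sharp (hf : IsIndecomposable (poly D m f)) :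
    IsIndecomposable (poly D m (sharp D m hreal hnb f)) := by
  rw [isIndecomposable_toSkew_iff] at hf ⊢
  refine ⟨hf.1, fun E hE hEE => ?_⟩
  obtain ⟨N, hLN, hNL⟩ := exists_sharpMat_inv D m hreal hnb f
  have hkey := companion_sharp D m hreal hnb f
  set L := sharpMat D m hreal hnb f with hL
  set G := companion (sharp D m hreal hnb f) with hG
  set c := conj D m hreal with hc
  set T := tau D m with hT
  have hξ := xi_ne_zero D m hnb
  set F' := ((companion f).map c)ᵀ with hF'
  let E' : Matrix (Fin f.d) (Fin f.d) (K m) := N * E * L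
  have hEL : E * L = L * E' := by
    change E * L = L * (N * E * L)
    rw [← Matrix.mul_assoc, ← Matrix.mul_assoc, hLN, Matrix.one_mul]
  have hmapLN : N.map T * L.map T = (1 : Matrix (Fin f.d) (Fin f.d) (K m)) := by
    rw [← Matrix.map_mul, hNL, Matrix.map_one _ (map_zero _) (map_one _)]
  have hGinv := companion_inv_mul (sharp D m hreal hnb f)
  -- Substitute L = ξ G τ(L) F' in E L = L E', move E past G and τ(L), and cancel the invertible
  -- factor G τ(L) on the left.
  have hcomm : E'.map T * F' = F' * E' := by
    have h1 : G * L.map T * (E'.map T * F') = G * L.map T * (F' * E') := by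
      have h2 : E * (G * L.map T * F') = G * L.map T * F' * E' := by
        have h3 := hEL
        rw [← hkey, Matrix.mul_smul, Matrix.smul_mul] at h3
        exact smul_right_injective _ hξ h3
      have h4 : E * (G * L.map T * F') = G * L.map T * (E'.map T * F') := by
        have h5 : E.map T * L.map T = L.map T * E'.map T := by
          rw [← Matrix.map_mul, hEL, Matrix.map_mul]
        rw [← Matrix.mul_assoc, ← Matrix.mul_assoc, hE, Matrix.mul_assoc G, h5,
          ← Matrix.mul_assoc, Matrix.mul_assoc (G * L.map T)]
      rw [← h4, h2, Matrix.mul_assoc (G * L.map T)]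
    have h6 := congrArg (fun A => N.map T * (companion (sharp D m hreal hnb f))⁻¹ * A) h1
    have h7 : ∀ A : Matrix (Fin f.d) (Fin f.d) (K m), N.map T *
        (companion (sharp D m hreal hnb f))⁻¹ * (G * L.map T * A) = A := by
      intro A
      rw [Matrix.mul_assoc, ← Matrix.mul_assoc _ (G * L.map T), ← Matrix.mul_assoc _ G, hGinv,
        Matrix.one_mul, ← Matrix.mul_assoc, hmapLN, Matrix.one_mul]
    simpa only [h7] using h6
  -- Transposition reverses the products and conjugation turns F'ᵀ back into F_f; conjugation
  -- commutes with τ.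
  have hE'' : Intertwines T f f (E'.map c)ᵀ := by
    have h1 := congrArg (fun A : Matrix (Fin f.d) (Fin f.d) (K m) => (A.map c)ᵀ) hcomm
    simp only [Matrix.map_mul, Matrix.transpose_mul] at h1
    have h2 : (F'.map c)ᵀ = companion f := map_map_conj D m hreal (companion f)
    rw [h2, map_tau_map_conj] at h1
    exact h1.symm
  have hidem : E' * E' = E' := by
    change N * E * L * (N * E * L) = N * E * L
    rw [Matrix.mul_assoc, ← Matrix.mul_assoc L, ← Matrix.mul_assoc L, hLN, Matrix.one_mul,
      ← Matrix.mul_assoc, Matrix.mul_assoc N, hEE]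
  have hback : E = L * E' * N := by
    rw [← hEL, Matrix.mul_assoc, hLN, Matrix.mul_one]
  rcases hf.2 _ hE'' (by rw [← Matrix.transpose_mul, ← Matrix.map_mul, hidem]) with h | h
  · left
    have h1 : E' = 0 := by
      rw [← map_map_conj D m hreal E', ← Matrix.transpose_transpose (E'.map _), h]
      simp
    rw [hback, h1, Matrix.mul_zero, Matrix.zero_mul]
  · right
    have h1 : E' = 1 := by
      rw [← map_map_conj D m hreal E', ← Matrix.transpose_transpose (E'.map _), h]
      simp
    rw [hback, h1, Matrix.mul_one, hLN]

end sharpPoly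

/-! ### Indexing the orbit and transporting scalars along it. -/

section transport

variable {R : Type u} [CommRing R] (D : Datum R) (m : MaximalSpectrum R)

theorem shift_pow_coe (i : ℕ) (n : orbit D m) :
    ((shift D m ^ i) n).1 = (maxPerm D.sigma ^ i) n.1 := by
  induction i with
  | zero => rfl
  | succ i ih =>
    rw [pow_succ', pow_succ', Equiv.Perm.mul_apply, Equiv.Perm.mul_apply, ← ih]
    rfl

theorem shift_pow_card : (shift D m ^ Nat.card (orbit D m)) (base D m) = base D m := by
  refine Subtype.ext ?_
  rw [shift_pow_coe, ← maxPerm_pow]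
  exact maxPerm_period D m

theorem sameCycle_base (n : orbit D m) : (shift D m).SameCycle (base D m) n := by
  obtain ⟨⟨_, z, rfl⟩, h⟩ := n.2
  refine ⟨z, Subtype.ext (Eq.trans ?_ h)⟩
  have h1 := congrArg (fun e : Equiv.Perm (orbit D m) => (e (base D m)).1)
    ((maxPerm D.sigma).subtypePerm_zpow z fun _ => maxPerm_mem_orbit D m)
  exact h1

theorem sigma_pow_notMem (hnb : NoBreaks D m) (n : orbit D m) (i : ℕ) :
    ((D.sigma : RingAut R) ^ i) D.t ∉ n.1.asIdeal := by
  intro h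
  have h1 : (shift D m ^ i) ((shift D m ^ i)⁻¹ n) = n := by
    rw [← Equiv.Perm.mul_apply, mul_inv_cancel, Equiv.Perm.one_apply]
  have h2 := congrArg Subtype.val h1
  rw [shift_pow_coe, ← maxPerm_pow] at h2
  refine hnb ((shift D m ^ i)⁻¹ n).1 ((shift D m ^ i)⁻¹ n).2 ?_
  rw [← h2, mem_maxPerm, RingEquiv.symm_apply_apply] at h
  exact h

theorem prod_sigma_pow_succ {R : Type u} [CommRing R] (D : Datum R) (i : ℕ) :
    ∏ j ∈ Finset.Icc 1 (i + 1), ((D.sigma : RingAut R) ^ j) D.t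
      = D.sigma D.t * D.sigma (∏ j ∈ Finset.Icc 1 i, ((D.sigma : RingAut R) ^ j) D.t) := by
  induction i with
  | zero => simp
  | succ i ih =>
    rw [Finset.prod_Icc_succ_top (by omega), ih, mul_assoc,
      ← ih, Finset.prod_Icc_succ_top (show 1 ≤ i + 1 by omega), map_mul, pow_succ' _ (i + 1)]
    rfl

theorem mk_sigma_t_ne_zero (hnb : NoBreaks D m) (n : orbit D m) :
    Ideal.Quotient.mk (shift D m n).1.asIdeal (D.sigma D.t) ≠ 0 := by
  rw [Ne, Ideal.Quotient.eq_zero_iff_mem]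
  intro h
  refine hnb n.1 n.2 ?_
  have h1 := mem_maxPerm.mp h
  rwa [RingEquiv.symm_apply_apply] at h1

variable [Finite (orbit D m)]

theorem card_le_of_shift_pow {i : ℕ} (h0 : 0 < i) (h : (shift D m ^ i) (base D m) = base D m) :
    Nat.card (orbit D m) ≤ i := by
  have := Fintype.ofFinite (orbit D m)
  have : Fintype (MulAction.orbit (Subgroup.zpowers (maxPerm D.sigma)) m) := this
  have h1 := MulAction.minimalPeriod_eq_card (a := maxPerm D.sigma) (b := m)
  have h2 : Nat.card (orbit D m)
      = Function.minimalPeriod ((maxPerm D.sigma) • ·) m := by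
    rw [h1, ← Nat.card_eq_fintype_card]; rfl
  rw [h2]
  refine Nat.le_of_dvd h0
    ((MulAction.pow_smul_eq_iff_minimalPeriod_dvd (a := maxPerm D.sigma) (b := m)).mp ?_)
  have h3 := congrArg Subtype.val h
  rwa [shift_pow_coe] at h3

theorem exists_shift_pow (n : orbit D m) : ∃ i, 0 < i ∧ (shift D m ^ i) (base D m) = n := by
  obtain ⟨i, h0, -, h⟩ := (sameCycle_base D m n).exists_pow_eq''
  exact ⟨i, h0, h⟩

open Classical in
/-- The least `i > 0` with `σ^i(𝔪) = 𝔫`. -/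
def idx (n : orbit D m) : ℕ := Nat.find (exists_shift_pow D m n)

theorem idx_pos (n : orbit D m) : 0 < idx D m n := by
  classical
  exact (Nat.find_spec (exists_shift_pow D m n)).1

theorem shift_pow_idx (n : orbit D m) : (shift D m ^ idx D m n) (base D m) = n := by
  classical
  exact (Nat.find_spec (exists_shift_pow D m n)).2

theorem idx_le {n : orbit D m} {i : ℕ} (h0 : 0 < i) (h : (shift D m ^ i) (base D m) = n) :
    idx D m n ≤ i := by
  classical
  exact Nat.find_min' (exists_shift_pow D m n) ⟨h0, h⟩

/-- The index starts at 1, so 𝔪(ω) itself gets the full period p and not 0. This places the base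
point at the end of the round, where transport is τ and the accumulated twist is ξ. -/
theorem idx_base : idx D m (base D m) = Nat.card (orbit D m) := by
  have : Nonempty (orbit D m) := ⟨base D m⟩
  exact le_antisymm (idx_le D m Nat.card_pos (shift_pow_card D m))
    (card_le_of_shift_pow D m (idx_pos D m _) (shift_pow_idx D m _))

theorem idx_shift_base : idx D m (shift D m (base D m)) = 1 :=
  le_antisymm (idx_le D m one_pos (by rw [pow_one])) (idx_pos D m _)

theorem idx_shift {n : orbit D m} (hn : n ≠ base D m) :
    idx D m (shift D m n) = idx D m n + 1 := by
  refine le_antisymm (idx_le D m (Nat.succ_pos _) ?_) ?_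
  · rw [pow_succ', Equiv.Perm.mul_apply, shift_pow_idx]
  · have h1 := shift_pow_idx D m (shift D m n)
    obtain ⟨i, hi⟩ : ∃ i, idx D m (shift D m n) = i + 1 :=
      ⟨_, (Nat.sub_add_cancel (idx_pos D m _)).symm⟩
    rw [hi, pow_succ', Equiv.Perm.mul_apply] at h1
    have h2 := (shift D m).injective h1
    rw [hi]
    refine Nat.succ_le_succ (idx_le D m (Nat.pos_of_ne_zero ?_) h2)
    -- If i were 0, then 𝔫 would be the base point, which is excluded; only there does the index
    -- drop back to 1.
    rintro rfl
    exact hn h2.symm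

/-- Induction along the orbit, starting behind the base point and ending with it. -/
theorem orbit_induction {p : orbit D m → Prop} (h1 : p (shift D m (base D m)))
    (hs : ∀ n, n ≠ base D m → p n → p (shift D m n)) (n : orbit D m) : p n := by
  have key : ∀ i n, idx D m n = i + 1 → p n := by
    intro i
    induction i with
    | zero =>
      intro n hn
      have h := shift_pow_idx D m n
      rw [hn, zero_add, pow_one] at h
      rwa [← h]
    | succ i ih =>
      intro n hn
      obtain ⟨n, rfl⟩ := (shift D m).surjective n
      by_cases h : n = base D m
      · rwa [h]
      · rw [idx_shift D m h] at hn
        exact hs n h (ih n (by omega))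
  exact key (idx D m n - 1) n (Nat.sub_add_cancel (idx_pos D m n)).symm

theorem maxPerm_idx (n : orbit D m) :
    maxPerm ((D.sigma : RingAut R) ^ idx D m n : RingAut R) m = n.1 := by
  rw [maxPerm_pow]
  have h := congrArg Subtype.val (shift_pow_idx D m n)
  rwa [shift_pow_coe] at h

/-- The homomorphism `K_ω → K_𝔫` induced by `σ^i`, where `i > 0` is least with `σ^i(𝔪) = 𝔫`. -/
def transport (n : orbit D m) : K m →+* K n.1 :=
  up ((D.sigma : RingAut R) ^ idx D m n : RingAut R) (maxPerm_idx D m n)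

theorem transport_mk (n : orbit D m) (r : R) :
    transport D m n (Ideal.Quotient.mk m.asIdeal r)
      = Ideal.Quotient.mk n.1.asIdeal (((D.sigma : RingAut R) ^ idx D m n) r) := rfl

theorem transport_base (a : K m) : transport D m (base D m) a = tau D m a := by
  obtain ⟨r, rfl⟩ := Ideal.Quotient.mk_surjective a
  rw [transport_mk, tau_mk, idx_base]
  rfl

/-- The homomorphism `K_𝔫 → K_{σ(𝔫)}` induced by `σ`. -/
abbrev upShift {R : Type u} [CommRing R] (D : Datum R) (m : MaximalSpectrum R) (n : orbit D m) :
    K n.1 →+* K (shift D m n).1 := up D.sigma (shift_spec D m n)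

/-- The homomorphism `K_ω → K_{σ(𝔪)}` induced by `σ`. -/
abbrev upBase {R : Type u} [CommRing R] (D : Datum R) (m : MaximalSpectrum R) :
    K m →+* K (shift D m (base D m)).1 := up D.sigma (shift_spec D m (base D m))

theorem transport_shift_base (a : K m) :
    transport D m (shift D m (base D m)) a = upBase D m a := by
  obtain ⟨r, rfl⟩ := Ideal.Quotient.mk_surjective a
  rw [transport_mk, idx_shift_base, pow_one]
  rfl

theorem transport_shift {n : orbit D m} (hn : n ≠ base D m) (a : K m) :
    transport D m (shift D m n) a = upShift D m n (transport D m n a) := by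
  obtain ⟨r, rfl⟩ := Ideal.Quotient.mk_surjective a
  rw [transport_mk, idx_shift D m hn, pow_succ', transport_mk]
  rfl

/-- The class of `σ(t) σ²(t) ⋯ σ^i(t)` in `K_𝔫`, where `i > 0` is least with `σ^i(𝔪) = 𝔫`. -/
def twist (n : orbit D m) : K n.1 :=
  Ideal.Quotient.mk n.1.asIdeal (∏ i ∈ Finset.Icc 1 (idx D m n), ((D.sigma : RingAut R) ^ i) D.t)

theorem twist_base : twist D m (base D m) = xi D m := by
  rw [twist, idx_base, xi]
  rfl

theorem twist_shift_base : twist D m (shift D m (base D m))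
    = Ideal.Quotient.mk (shift D m (base D m)).1.asIdeal (D.sigma D.t) := by
  rw [twist, idx_shift_base, Finset.Icc_self, Finset.prod_singleton, pow_one]

theorem twist_shift {n : orbit D m} (hn : n ≠ base D m) : twist D m (shift D m n)
    = Ideal.Quotient.mk (shift D m n).1.asIdeal (D.sigma D.t) * upShift D m n (twist D m n) := by
  rw [twist, idx_shift D m hn, prod_sigma_pow_succ, map_mul]
  rfl

theorem twist_ne_zero (hnb : NoBreaks D m) (n : orbit D m) : twist D m n ≠ 0 := by
  rw [twist, map_prod]
  refine Finset.prod_ne_zero_iff.mpr fun i _ => ?_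
  rw [Ne, Ideal.Quotient.eq_zero_iff_mem]
  exact sigma_pow_notMem D m hnb n i

end transport

/-! ### Conjugation on the residue fields of a real orbit. -/

section conjugation

variable {R : Type u} [CommRing R] (D : Datum R) (m : MaximalSpectrum R)

/-- Conjugation on `K_𝔫`. -/
def conjAt (hreal : IsReal D m) (n : orbit D m) : K n.1 →+* K n.1 := up D.star (hreal n.1 n.2)

theorem conjAt_mk (hreal : IsReal D m) (n : orbit D m) (r : R) :
    conjAt D m hreal n (Ideal.Quotient.mk n.1.asIdeal r)
      = Ideal.Quotient.mk n.1.asIdeal (D.star r) := rfl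

theorem conjAt_upShift (hreal : IsReal D m) (n : orbit D m) (a : K n.1) :
    conjAt D m hreal (shift D m n) (upShift D m n a) = upShift D m n (conjAt D m hreal n a) := by
  obtain ⟨r, rfl⟩ := Ideal.Quotient.mk_surjective a
  exact congrArg (Ideal.Quotient.mk (shift D m n).1.asIdeal) (D.sigma_star r).symm

theorem star_mem (hreal : IsReal D m) {n : orbit D m} {r : R} (hr : r ∈ n.1.asIdeal) : D.star r ∈ n.1.asIdeal := by
  rw [← Ideal.Quotient.eq_zero_iff_mem] at hr ⊢
  rw [← conjAt_mk D m hreal, hr, map_zero]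

end conjugation

/-! ### Linear maps out of V(ω, f), and its weight components. -/

section linearity

variable {R : Type u} [CommRing R] (D : Datum R)

theorem Alg.induction {p : Alg D → Prop} (hR : ∀ r, p (Alg.ofR D r)) (hX : p (Alg.X D))
    (hY : p (Alg.Y D)) (hadd : ∀ a b, p a → p b → p (a + b))
    (hmul : ∀ a b, p a → p b → p (a * b)) (a : Alg D) : p a := by
  obtain ⟨b, rfl⟩ := RingQuot.mkRingHom_surjective (Rel D) a
  change p (Alg.mk D b)
  induction b using FreeAlgebra.induction with
  | grade0 z =>
    have h : Alg.mk D (algebraMap ℤ _ z) = Alg.ofR D z := by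
      rw [eq_intCast, map_intCast, map_intCast]
    rw [h]
    exact hR _
  | grade1 g =>
    cases g with
    | coe r => exact hR r
    | X => exact hX
    | Y => exact hY
  | mul a b ha hb => rw [map_mul]; exact hmul _ _ ha hb
  | add a b ha hb => rw [map_add]; exact hadd _ _ ha hb

/-- Additive maps that commute with `R`, `X` and `Y` are `A`-linear. -/
theorem Alg.map_smul_of_gen {M N : Type*} [AddCommGroup M] [AddCommGroup N] [Module (Alg D) M]
    [Module (Alg D) N] (φ : M →+ N) (hR : ∀ r v, φ (Alg.ofR D r • v) = Alg.ofR D r • φ v)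
    (hX : ∀ v, φ (Alg.X D • v) = Alg.X D • φ v) (hY : ∀ v, φ (Alg.Y D • v) = Alg.Y D • φ v)
    (a : Alg D) (v : M) : φ (a • v) = a • φ v := by
  induction a using Alg.induction generalizing v with
  | hR r => exact hR r v
  | hX => exact hX v
  | hY => exact hY v
  | hadd a b ha hb => rw [add_smul, map_add, ha, hb, add_smul]
  | hmul a b ha hb => rw [mul_smul, ha, hb, mul_smul]

variable (m : MaximalSpectrum R) (f : Coeffs (K m))

theorem VAction_ofR (r : R) (v : V D m f) : Alg.ofR D r • v = r • v :=
  congrArg (fun e : AddMonoid.End (V D m f) => e v) (Alg.lift_ofR D _ _ _ _ _ _ _ r)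

theorem VAction_X (v : V D m f) : Alg.X D • v = XV D m f v :=
  congrArg (fun e : AddMonoid.End (V D m f) => e v) (Alg.lift_X D _ _ _ _ _ _ _)

theorem VAction_Y (v : V D m f) : Alg.Y D • v = YV D m f v :=
  congrArg (fun e : AddMonoid.End (V D m f) => e v) (Alg.lift_Y D _ _ _ _ _ _ _)

theorem X_smul_of (n : orbit D m) (v : Fin f.d → K n.1) : Alg.X D • V.of D m f n v
    = V.of D m f (shift D m n) (Xcomp D m f n _ (shift_spec D m n) v) := by
  rw [VAction_X, XV_of]

theorem Y_smul_of_shift (n : orbit D m) (v : Fin f.d → K (shift D m n).1) :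
    Alg.Y D • V.of D m f (shift D m n) v
      = V.of D m f n (Ycomp D m f n _ (shift_spec D m n) v) := by
  have key : ∀ (n n1 : orbit D m) (n' : MaximalSpectrum R) (_ : n1 = n)
      (h : maxPerm D.sigma n1.1 = n') (h0 : maxPerm D.sigma n.1 = n') (v : Fin f.d → K n'),
      V.of D m f n1 (Ycomp D m f n1 n' h v) = V.of D m f n (Ycomp D m f n n' h0 v) := by
    rintro n _ n' rfl h h0 v
    rfl
  rw [VAction_Y, YV_of]
  exact key _ _ _ (Equiv.symm_apply_apply _ _) _ _ _

theorem ofR_smul_of (r : R) (n : orbit D m) (v : Fin f.d → K n.1) :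
    Alg.ofR D r • V.of D m f n v = V.of D m f n (Ideal.Quotient.mk n.1.asIdeal r • v) := by
  rw [VAction_ofR, smul_of]
  rfl

/-- On the weight space at σ(𝔫) the product XY is the scalar σ(t), which is nonzero because t ∉ 𝔫.
The preimage is therefore Y applied to σ(t)⁻¹v. -/
theorem exists_X_smul_eq (hnb : NoBreaks D m) (v : V D m f) : ∃ w, Alg.X D • w = v := by
  induction v using V.induction with
  | h0 => exact ⟨0, smul_zero _⟩
  | hof n v =>
    obtain ⟨n, rfl⟩ := (shift D m).surjective n
    have h0 := mk_sigma_t_ne_zero D m hnb n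
    refine ⟨V.of D m f n (Ycomp D m f n _ (shift_spec D m n)
      ((Ideal.Quotient.mk (shift D m n).1.asIdeal (D.sigma D.t))⁻¹ • v)), ?_⟩
    rw [X_smul_of, Xcomp_Ycomp]
    congr 1
    change Ideal.Quotient.mk (shift D m n).1.asIdeal (D.sigma D.t) • _ • v = v
    rw [smul_smul, mul_inv_cancel₀ h0, one_smul]
  | hadd a b ha hb =>
    obtain ⟨v, hv⟩ := ha
    obtain ⟨w, hw⟩ := hb
    exact ⟨v + w, by rw [smul_add, hv, hw]⟩

variable {D m f}

/-- The additive map out of `V(ω, f)` with given components. -/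
def V.liftAdd {N : Type*} [AddCommGroup N] (θ : ∀ n : orbit D m, (Fin f.d → K n.1) →+ N) :
    V D m f →+ N :=
  open Classical in (DirectSum.toAddMonoid θ : (⨁ n : orbit D m, (Fin f.d → K n.1)) →+ N)

theorem V.liftAdd_of {N : Type*} [AddCommGroup N] (θ : ∀ n : orbit D m, (Fin f.d → K n.1) →+ N)
    (n : orbit D m) (v : Fin f.d → K n.1) : V.liftAdd θ (V.of D m f n v) = θ n v := by
  classical
  exact DirectSum.toAddMonoid_of _ _ _

/-- The `A`-linear map out of `V(ω, f)` with given components, if these commute with `R`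
and `X`. -/
def V.lift (hnb : NoBreaks D m) {N : Type*} [AddCommGroup N] [Module (Alg D) N]
    (θ : ∀ n : orbit D m, (Fin f.d → K n.1) →+ N)
    (hR : ∀ r n v, θ n (Ideal.Quotient.mk n.1.asIdeal r • v) = Alg.ofR D r • θ n v)
    (hX : ∀ n v, θ (shift D m n) (Xcomp D m f n _ (shift_spec D m n) v) = Alg.X D • θ n v) :
    V D m f →ₗ[Alg D] N where
  toFun := V.liftAdd θ
  map_add' := map_add (V.liftAdd θ)
  map_smul' := by
    have hR' : ∀ r v, V.liftAdd θ (Alg.ofR D r • v) = Alg.ofR D r • V.liftAdd θ v := by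
      intro r v
      induction v using V.induction with
      | h0 => rw [smul_zero, map_zero, smul_zero]
      | hof n v => rw [ofR_smul_of, V.liftAdd_of, V.liftAdd_of, hR]
      | hadd a b ha hb => rw [smul_add, map_add, map_add, smul_add, ha, hb]
    have hX' : ∀ v, V.liftAdd θ (Alg.X D • v) = Alg.X D • V.liftAdd θ v := by
      intro v
      induction v using V.induction with
      | h0 => rw [smul_zero, map_zero, smul_zero]
      | hof n v => rw [X_smul_of, V.liftAdd_of, V.liftAdd_of, hX]
      | hadd a b ha hb => rw [smul_add, map_add, map_add, smul_add, ha, hb]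
    -- Commutation with Y is not an extra condition: every vector has the form Xw, and YX = t lies
    -- in R.
    refine Alg.map_smul_of_gen D (V.liftAdd θ) hR' hX' fun v => ?_
    obtain ⟨w, rfl⟩ := exists_X_smul_eq D m f hnb v
    rw [hX', ← mul_smul, ← mul_smul, Alg.Y_mul_X, hR']

theorem V.lift_of (hnb : NoBreaks D m) {N : Type*} [AddCommGroup N] [Module (Alg D) N]
    (θ : ∀ n : orbit D m, (Fin f.d → K n.1) →+ N)
    (hR : ∀ r n v, θ n (Ideal.Quotient.mk n.1.asIdeal r • v) = Alg.ofR D r • θ n v)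
    (hX : ∀ n v, θ (shift D m n) (Xcomp D m f n _ (shift_spec D m n) v) = Alg.X D • θ n v)
    (n : orbit D m) (v : Fin f.d → K n.1) : V.lift hnb θ hR hX (V.of D m f n v) = θ n v :=
  V.liftAdd_of θ n v

/-- The component of an element of `V(ω, f)` in `(K_𝔫)^d`. -/
def V.coord (n : orbit D m) : V D m f →+ (Fin f.d → K n.1) :=
  DFinsupp.evalAddMonoidHom (β := fun n : orbit D m => Fin f.d → K n.1) n

theorem V.coord_of (n : orbit D m) (v : Fin f.d → K n.1) : V.coord n (V.of D m f n v) = v := by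
  classical
  exact DirectSum.of_eq_same (β := fun n : orbit D m => Fin f.d → K n.1) n v

theorem V.coord_of_ne {n n' : orbit D m} (h : n ≠ n') (v : Fin f.d → K n.1) :
    V.coord n' (V.of D m f n v) = 0 := by
  classical
  exact DirectSum.of_eq_of_ne (β := fun n : orbit D m => Fin f.d → K n.1) n n' v h.symm

theorem V.ext_coord {v w : V D m f} (h : ∀ n, V.coord n v = V.coord n w) : v = w :=
  DFinsupp.ext h

theorem V.coord_ofR_smul (r : R) (n : orbit D m) (v : V D m f) :
    V.coord n (Alg.ofR D r • v) = Ideal.Quotient.mk n.1.asIdeal r • V.coord n v := by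
  rw [VAction_ofR]
  rfl

theorem exists_mem_notMem {n n' : MaximalSpectrum R} (h : n ≠ n') :
    ∃ r ∈ n.asIdeal, r ∉ n'.asIdeal := by
  refine Set.not_subset.mp fun hs => h (MaximalSpectrum.ext ?_)
  exact n.isMaximal.eq_of_le n'.isMaximal.ne_top hs

/-- Some r in the first ideal lies outside the second. It kills the vector but acts invertibly on
the component. -/
theorem V.coord_eq_zero {n : MaximalSpectrum R} {n' : orbit D m} (h : n ≠ n'.1) {v : V D m f}
    (hv : v ∈ weightSpace D (V D m f) n) : V.coord n' v = 0 := by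
  obtain ⟨r, hr, hr'⟩ := exists_mem_notMem h
  have h1 := congrArg (V.coord n') (hv r hr)
  rw [V.coord_ofR_smul, map_zero] at h1
  refine (smul_eq_zero.mp h1).resolve_left ?_
  rwa [Ideal.Quotient.eq_zero_iff_mem]

theorem V.eq_of_coord {n : orbit D m} {v : V D m f} (hv : v ∈ weightSpace D (V D m f) n.1) :
    V.of D m f n (V.coord n v) = v := by
  refine V.ext_coord fun n' => ?_
  by_cases h : n = n'
  · subst h
    rw [V.coord_of]
  · rw [V.coord_of_ne h, V.coord_eq_zero (fun hc => h (Subtype.ext hc)) hv]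

theorem V.of_mem (n : orbit D m) (v : Fin f.d → K n.1) :
    V.of D m f n v ∈ weightSpace D (V D m f) n.1 := by
  intro r hr
  rw [ofR_smul_of, Ideal.Quotient.eq_zero_iff_mem.mpr hr, zero_smul, map_zero]

end linearity

/-! ### Isomorphisms V(ω, f) ≅ V(ω, g) and similarity. -/

section isomorphisms

variable {R : Type u} [CommRing R] {D : Datum R} {m : MaximalSpectrum R} {f g : Coeffs (K m)}

theorem Xcomp_base (v : Fin f.d → K m) :
    Xcomp D m f (base D m) _ (shift_spec D m (base D m)) v
      = upBase D m ∘ (companion f).mulVec (Ideal.Quotient.mk m.asIdeal D.t • v) := by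
  change upBase D m ∘ (matAt D m f (companion f) (base D m)).mulVec (D.t • v) = _
  rw [matAt_base]
  rfl

theorem Xcomp_ne {n : orbit D m} (hn : n ≠ base D m) (v : Fin f.d → K n.1) :
    Xcomp D m f n _ (shift_spec D m n) v
      = upShift D m n ∘ (Ideal.Quotient.mk n.1.asIdeal D.t • v) := by
  change upShift D m n ∘ (matAt D m f (companion f) n).mulVec (D.t • v) = _
  rw [matAt_of_ne _ _ _ _ _ hn, Matrix.one_mulVec]
  rfl

theorem Ycomp_base (v : Fin f.d → K m) :
    Ycomp D m f (base D m) _ (shift_spec D m (base D m)) (upBase D m ∘ v)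
      = (companion f)⁻¹.mulVec v := by
  change (matAt D m f (companion f)⁻¹ (base D m)).mulVec _ = _
  rw [matAt_base]
  congr 1
  exact funext fun i => down_up _ _ _

theorem Ycomp_ne {n : orbit D m} (hn : n ≠ base D m) (v : Fin f.d → K n.1) :
    Ycomp D m f n _ (shift_spec D m n) (upShift D m n ∘ v) = v := by
  change (matAt D m f (companion f)⁻¹ n).mulVec _ = _
  rw [matAt_of_ne _ _ _ _ _ hn, Matrix.one_mulVec]
  exact funext fun i => down_up _ _ _

/-- The map induced on a weight space by a homomorphism. -/
def V.mapAt (φ : V D m f →ₗ[Alg D] V D m g) (n : orbit D m) :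
    (Fin f.d → K n.1) →ₗ[K n.1] (Fin g.d → K n.1) where
  toFun v := V.coord n (φ (V.of D m f n v))
  map_add' v w := by rw [map_add, map_add, map_add]
  map_smul' a v := by
    obtain ⟨r, rfl⟩ := Ideal.Quotient.mk_surjective a
    rw [← ofR_smul_of, map_smul, V.coord_ofR_smul]
    rfl

theorem V.map_mem_weightSpace (φ : V D m f →ₗ[Alg D] V D m g) {n : MaximalSpectrum R}
    {v : V D m f} (hv : v ∈ weightSpace D (V D m f) n) : φ v ∈ weightSpace D (V D m g) n :=
  fun r hr => by rw [← map_smul, hv r hr, map_zero]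

theorem V.of_mapAt (φ : V D m f →ₗ[Alg D] V D m g) (n : orbit D m) (v : Fin f.d → K n.1) :
    V.of D m g n (V.mapAt φ n v) = φ (V.of D m f n v) :=
  V.eq_of_coord (V.map_mem_weightSpace φ (V.of_mem _ _))

theorem V.of_injective (n : orbit D m) : Function.Injective (V.of D m f n) :=
  Function.LeftInverse.injective (V.coord_of n)

/-- The matrix of the map induced on the weight space at `𝔪(ω)` by a homomorphism. -/
def V.baseMatrix (φ : V D m f →ₗ[Alg D] V D m g) : Matrix (Fin g.d) (Fin f.d) (K m) :=
  LinearMap.toMatrix' (V.mapAt φ (base D m))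

theorem V.of_baseMatrix_mulVec (φ : V D m f →ₗ[Alg D] V D m g) (v : Fin f.d → K m) :
    V.of D m g (base D m) ((V.baseMatrix φ).mulVec v) = φ (V.of D m f (base D m) v) :=
  (congrArg (V.of D m g (base D m)) (LinearMap.toMatrix'_mulVec (V.mapAt φ (base D m)) v)).trans
    (V.of_mapAt φ (base D m) v)

theorem V.baseMatrix_mul_eq_one {φ : V D m f →ₗ[Alg D] V D m g} {ψ : V D m g →ₗ[Alg D] V D m f}
    (h : ∀ v, ψ (φ v) = v) : V.baseMatrix ψ * V.baseMatrix φ = 1 := by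
  refine Matrix.ext_of_mulVec_single fun j => V.of_injective (base D m) ?_
  rw [← Matrix.mulVec_mulVec, V.of_baseMatrix_mulVec, V.of_baseMatrix_mulVec, h,
    Matrix.one_mulVec]

variable [Finite (orbit D m)]

/-- The homomorphism `V(ω, f) → V(ω, g)` given by a matrix. -/
def V.hom (hnb : NoBreaks D m) {G : Matrix (Fin g.d) (Fin f.d) (K m)}
    (hG : Intertwines (tau D m) f g G) : V D m f →ₗ[Alg D] V D m g :=
  V.lift hnb (fun n => (V.of D m g n).comp
      (G.map (transport D m n)).mulVecLin.toAddMonoidHom)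
    (fun r n v => by
      refine Eq.trans ?_ (ofR_smul_of D m g r n _).symm
      exact congrArg (V.of D m g n) (map_smul (G.map (transport D m n)).mulVecLin _ _))
    (fun n v => by
      refine Eq.trans ?_ (X_smul_of D m g n _).symm
      refine congrArg (V.of D m g (shift D m n)) ?_
      change (G.map (transport D m (shift D m n))).mulVec _
        = Xcomp D m g n _ (shift_spec D m n) ((G.map (transport D m n)).mulVec v)
      -- At the base point the incoming matrix is τ(G) and the outgoing one is σ(G), with F_f and
      -- F_g acting between them, so the intertwining relation is what is required. Elsewhere both
      -- sides merely apply σ.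
      by_cases hn : n = base D m
      · subst hn
        have h1 : G.map (transport D m (shift D m (base D m)))
            = G.map (upBase D m) :=
          Matrix.ext fun i j => transport_shift_base D m _
        have h2 : G.map (transport D m (base D m)) = G.map (tau D m) :=
          Matrix.ext fun i j => transport_base D m _
        refine (congrArg _ (Xcomp_base v)).trans (Eq.trans ?_ (Xcomp_base _).symm)
        have h3 : ∀ (a : K m) (v : Fin f.d → K m), G.mulVec ((companion f).mulVec (a • v))
            = (companion g).mulVec (a • (G.map (tau D m)).mulVec v) := by
          intro a v
          rw [← Matrix.mulVec_smul, Matrix.mulVec_mulVec, Matrix.mulVec_mulVec, hG]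
        rw [h1, h2, ← map_comp_mulVec]
        exact congrArg (upBase D m ∘ ·) (h3 _ v)
      · have h1 : G.map (transport D m (shift D m n))
            = (G.map (transport D m n)).map (upShift D m n) :=
          Matrix.ext fun i j => transport_shift D m hn _
        rw [Xcomp_ne hn, Xcomp_ne hn, h1, ← map_comp_mulVec, Matrix.mulVec_smul])

theorem V.hom_of (hnb : NoBreaks D m) {G : Matrix (Fin g.d) (Fin f.d) (K m)}
    (hG : Intertwines (tau D m) f g G) (n : orbit D m) (v : Fin f.d → K n.1) :
    V.hom hnb hG (V.of D m f n v) = V.of D m g n ((G.map (transport D m n)).mulVec v) :=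
  V.lift_of _ _ _ _ n v

/-- Y undoes one transport step at a time and contributes F_f⁻¹ only on its arrival at 𝔪(ω). Unlike
X it introduces no factors of t. The exponent must not depend on f, since one power of Y is later
compared on two modules. -/
theorem exists_Y_pow_smul (n : orbit D m) : ∃ i, ∀ (f : Coeffs (K m)) (w : Fin f.d → K m),
    Alg.Y D ^ i • V.of D m f n (transport D m n ∘ w)
      = V.of D m f (base D m) ((companion f)⁻¹.mulVec w) := by
  induction n using orbit_induction with
  | h1 =>
    refine ⟨1, fun f w => ?_⟩
    have h : transport D m (shift D m (base D m)) ∘ w = upBase D m ∘ w :=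
      funext fun i => transport_shift_base D m _
    rw [h, pow_one, Y_smul_of_shift, Ycomp_base]
  | hs n hn ih =>
    obtain ⟨i, hi⟩ := ih
    refine ⟨i + 1, fun f w => ?_⟩
    have h : transport D m (shift D m n) ∘ w = upShift D m n ∘ (transport D m n ∘ w) :=
      funext fun i => transport_shift D m hn _
    rw [h, pow_succ, mul_smul, Y_smul_of_shift, Ycomp_ne hn, hi]

theorem intertwines_inv {τ : RingAut (K m)} {G : Matrix (Fin g.d) (Fin f.d) (K m)}
    {H : Matrix (Fin f.d) (Fin g.d) (K m)} (hG : Intertwines τ f g G) (hGH : G * H = 1)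
    (hHG : H * G = 1) : Intertwines τ g f H := by
  have h1 : G.map τ * H.map τ = 1 := by
    rw [← Matrix.map_mul, hGH, Matrix.map_one _ (map_zero _) (map_one _)]
  calc H * companion g = H * (companion g * (G.map τ * H.map τ)) := by rw [h1, Matrix.mul_one]
    _ = H * (G * companion f) * H.map τ := by
      rw [hG]; simp only [Matrix.mul_assoc]
    _ = companion f * H.map τ := by rw [← Matrix.mul_assoc, hHG, Matrix.one_mul]

theorem nonempty_V_equiv_of_intertwines (hnb : NoBreaks D m)
    {G : Matrix (Fin g.d) (Fin f.d) (K m)} {H : Matrix (Fin f.d) (Fin g.d) (K m)}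
    (hG : Intertwines (tau D m) f g G) (hGH : G * H = 1) (hHG : H * G = 1) :
    Nonempty (V D m f ≃ₗ[Alg D] V D m g) := by
  have hH := intertwines_inv hG hGH hHG
  have key : ∀ {f g : Coeffs (K m)} {G : Matrix (Fin g.d) (Fin f.d) (K m)}
      {H : Matrix (Fin f.d) (Fin g.d) (K m)} (hG : Intertwines (tau D m) f g G)
      (hH : Intertwines (tau D m) g f H), H * G = 1 → ∀ v, V.hom hnb hH (V.hom hnb hG v) = v := by
    intro f g G H hG hH hHG v
    induction v using V.induction with
    | h0 => rw [map_zero, map_zero]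
    | hof n v =>
      rw [V.hom_of, V.hom_of, Matrix.mulVec_mulVec, ← Matrix.map_mul, hHG,
        Matrix.map_one _ (map_zero _) (map_one _), Matrix.one_mulVec]
    | hadd a b ha hb => rw [map_add, map_add, ha, hb]
  exact ⟨LinearEquiv.ofLinearMap (V.hom hnb hG) (V.hom hnb hH)
    (LinearMap.ext (key hH hG hGH)) (LinearMap.ext (key hG hH hHG))⟩

/-- Let A be the matrix of the isomorphism at 𝔪(ω). Commutation with one full round of Y reads A
F_f⁻¹ = F_g⁻¹ τ⁻¹(A), so τ⁻¹(A), and not A, is the intertwining matrix. -/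
theorem exists_intertwines_of_equiv (φ : V D m f ≃ₗ[Alg D] V D m g) :
    ∃ (G : Matrix (Fin g.d) (Fin f.d) (K m)) (H : Matrix (Fin f.d) (Fin g.d) (K m)),
      Intertwines (tau D m) f g G ∧ G * H = 1 ∧ H * G = 1 := by
  have h1 : V.baseMatrix φ.symm.toLinearMap * V.baseMatrix φ.toLinearMap = 1 :=
    V.baseMatrix_mul_eq_one φ.symm_apply_apply
  have h2 : V.baseMatrix φ.toLinearMap * V.baseMatrix φ.symm.toLinearMap = 1 :=
    V.baseMatrix_mul_eq_one φ.apply_symm_apply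
  let τ' := (tau D m).symm
  set A := V.baseMatrix φ.toLinearMap with hA
  set B := V.baseMatrix φ.symm.toLinearMap with hB
  refine ⟨A.map τ', B.map τ', ?_, ?_, ?_⟩
  · have hA' : (A.map τ').map (tau D m) = A := Matrix.ext fun i j => (tau D m).apply_symm_apply _
    -- Taken at the base point, this power of Y sends τ(w) to F_f⁻¹w.
    obtain ⟨i, hi⟩ := exists_Y_pow_smul (base D m)
    have h3 : A * (companion f)⁻¹ = (companion g)⁻¹ * A.map τ' := by
      refine Matrix.ext_of_mulVec_single fun j => V.of_injective (base D m) ?_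
      set w : Fin f.d → K m := Pi.single j 1
      rw [← Matrix.mulVec_mulVec, ← Matrix.mulVec_mulVec, ← hi, hA,
        V.of_baseMatrix_mulVec, ← hi]
      refine (φ.map_smul _ _).trans (congrArg _ ?_)
      have h4 : transport D m (base D m) ∘ (A.map τ').mulVec w
          = A.mulVec (transport D m (base D m) ∘ w) := by
        have h5 := map_comp_mulVec (transport D m (base D m)) (A.map τ') w
        rw [h5]
        congr 1
        refine Matrix.ext fun i j => ?_
        exact (transport_base D m _).trans ((tau D m).apply_symm_apply _)
      rw [h4]
      exact (V.of_baseMatrix_mulVec φ.toLinearMap _).symm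
    rw [Intertwines, hA']
    calc A.map τ' * companion f = companion g * ((companion g)⁻¹ * A.map τ') * companion f := by
          rw [← Matrix.mul_assoc, companion_mul_inv, Matrix.one_mul]
      _ = companion g * A := by
          rw [← h3, Matrix.mul_assoc, Matrix.mul_assoc, companion_inv_mul, Matrix.mul_one]
  · rw [← Matrix.map_mul, h2, Matrix.map_one _ (map_zero _) (map_one _)]
  · rw [← Matrix.map_mul, h1, Matrix.map_one _ (map_zero _) (map_one _)]

theorem nonempty_V_equiv_iff (hnb : NoBreaks D m) :
    Nonempty (V D m f ≃ₗ[Alg D] V D m g) ↔ IsSimilar (poly D m f) (poly D m g) := by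
  rw [isSimilar_toSkew_iff]
  constructor
  · rintro ⟨φ⟩
    exact exists_intertwines_of_equiv φ
  · rintro ⟨G, H, hG, hGH, hHG⟩
    exact nonempty_V_equiv_of_intertwines hnb hG hGH hHG

end isomorphisms

/-! ### The finitistic dual of V(ω, f) is V(ω, f♯). -/

section dualModule

variable {R : Type u} [CommRing R] {D : Datum R} {m : MaximalSpectrum R}

/-- The component of an element of `R_ω` in `K_𝔫`. -/
def Rom.coord (n : orbit D m) : Rom D m →+ K n.1 :=
  DFinsupp.evalAddMonoidHom (β := fun n : orbit D m => K n.1) n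

theorem Rom.coord_of (n : orbit D m) (a : K n.1) : Rom.coord n (Rom.of D m n a) = a := by
  classical
  exact DirectSum.of_eq_same (β := fun n : orbit D m => K n.1) n a

theorem Rom.coord_of_ne {n n' : orbit D m} (h : n ≠ n') (a : K n.1) :
    Rom.coord n' (Rom.of D m n a) = 0 := by
  classical
  exact DirectSum.of_eq_of_ne (β := fun n : orbit D m => K n.1) n n' a h.symm

theorem Rom.coord_smul (r : R) (n : orbit D m) (a : Rom D m) :
    Rom.coord n (r • a) = Ideal.Quotient.mk n.1.asIdeal r * Rom.coord n a := rfl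

theorem Rom.smul_of (r : R) (n : orbit D m) (a : K n.1) :
    r • Rom.of D m n a = Rom.of D m n (Ideal.Quotient.mk n.1.asIdeal r * a) := by
  classical
  exact (DirectSum.of_smul R (M := fun n : orbit D m => K n.1) n r a).symm

theorem Rom.eq_of_coord {n : orbit D m} {a : Rom D m} (ha : ∀ r ∈ n.1.asIdeal, r • a = 0) :
    Rom.of D m n (Rom.coord n a) = a := by
  refine DFinsupp.ext fun n' => ?_
  change Rom.coord n' (Rom.of D m n (Rom.coord n a)) = Rom.coord n' a
  by_cases h : n = n'
  · subst h
    rw [Rom.coord_of]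
  · obtain ⟨r, hr, hr'⟩ := exists_mem_notMem fun hc => h (Subtype.ext hc)
    have h1 := congrArg (Rom.coord n') (ha r hr)
    rw [Rom.coord_smul, map_zero] at h1
    rw [Rom.coord_of_ne h]
    refine ((mul_eq_zero.mp h1).resolve_left ?_).symm
    rwa [Ideal.Quotient.eq_zero_iff_mem]

theorem Dual.ext {V : Type v} [AddCommGroup V] [Module (Alg D) V] {φ ψ : Dual D V m}
    (h : ∀ v, φ.1 v = ψ.1 v) : φ = ψ :=
  Subtype.ext (AddMonoidHom.ext h)

theorem Dual.ofR_smul_apply {V : Type v} [AddCommGroup V] [Module (Alg D) V] (r : R)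
    (φ : Dual D V m) (v : V) : (Alg.ofR D r • φ).1 v = φ.1 (Alg.ofR D (D.star r) • v) :=
  congrArg (fun e : AddMonoid.End (Dual D V m) => (e φ).1 v) (Alg.lift_ofR D _ _ _ _ _ _ _ r)

theorem Dual.X_smul_apply {V : Type v} [AddCommGroup V] [Module (Alg D) V]
    (φ : Dual D V m) (v : V) : (Alg.X D • φ).1 v = sigmaFwd D m (φ.1 (Alg.Y D • v)) :=
  congrArg (fun e : AddMonoid.End (Dual D V m) => (e φ).1 v) (Alg.lift_X D _ _ _ _ _ _ _)

theorem Dual.Y_smul_apply {V : Type v} [AddCommGroup V] [Module (Alg D) V]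
    (φ : Dual D V m) (v : V) : (Alg.Y D • φ).1 v = sigmaBwd D m (φ.1 (Alg.X D • v)) :=
  congrArg (fun e : AddMonoid.End (Dual D V m) => (e φ).1 v) (Alg.lift_Y D _ _ _ _ _ _ _)

variable {f g : Coeffs (K m)}

theorem V.coord_X_smul (n : orbit D m) (v : V D m f) : V.coord (shift D m n) (Alg.X D • v)
    = Xcomp D m f n _ (shift_spec D m n) (V.coord n v) := by
  induction v using V.induction with
  | h0 => rw [smul_zero, map_zero, map_zero, map_zero]
  | hof n' v =>
    rw [X_smul_of]
    by_cases h : n' = n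
    · subst h
      rw [V.coord_of, V.coord_of]
    · rw [V.coord_of_ne h, V.coord_of_ne fun hc => h ((shift D m).injective hc), map_zero]
  | hadd a b ha hb => rw [smul_add, map_add, map_add, map_add, ha, hb]

/-- `companion_sharp` rewritten for N = L⁻¹, in the form needed for the pairing at the base point.
It exhibits ξ N F_{f♯} τ(L) as a left inverse of conj(F_f)ᵀ, hence also a right inverse, these being
square matrices. -/
theorem conj_sharpMat_inv {hreal : IsReal D m} {hnb : NoBreaks D m}
    {N : Matrix (Fin f.d) (Fin (sharp D m hreal hnb f).d) (K m)}
    (hNL : N * sharpMat D m hreal hnb f = (1 : Matrix (Fin f.d) (Fin f.d) (K m)))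
    (hLN : sharpMat D m hreal hnb f * N = (1 : Matrix (Fin (sharp D m hreal hnb f).d) _ (K m))) :
    xi D m • (((companion f).map (conj D m hreal))ᵀ * (N * companion (sharp D m hreal hnb f)))
      = N.map (tau D m) := by
  have h := companion_sharp D m hreal hnb f
  set L := sharpMat D m hreal hnb f
  set G := companion (sharp D m hreal hnb f)
  set F' := ((companion f).map (conj D m hreal))ᵀ
  have h1 : (xi D m • (N * G * L.map (tau D m))) * F' = (1 : Matrix (Fin f.d) (Fin f.d) (K m)) := by
    rw [Matrix.smul_mul, Matrix.mul_assoc, Matrix.mul_assoc, ← Matrix.mul_smul,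
      ← Matrix.mul_assoc G, h, hNL]
  have h2 := mul_eq_one_comm.mp h1
  have h3 : L.map (tau D m) * N.map (tau D m)
      = (1 : Matrix (Fin (sharp D m hreal hnb f).d) (Fin (sharp D m hreal hnb f).d) (K m)) := by
    rw [← Matrix.map_mul, hLN, Matrix.map_one _ (map_zero _) (map_one _)]
  have h4 := congrArg (fun A : Matrix (Fin f.d) (Fin f.d) (K m) => A * N.map (tau D m)) h2
  simp only [Matrix.one_mul, Matrix.mul_smul, Matrix.smul_mul] at h4
  rw [← h4]
  congr 1
  rw [Matrix.mul_assoc F', Matrix.mul_assoc (N * G), h3]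
  exact congrArg (F' * ·) (Matrix.mul_one (N * G)).symm

theorem conjAt_mk_t (hreal : IsReal D m) (n : orbit D m) :
    conjAt D m hreal n (Ideal.Quotient.mk n.1.asIdeal D.t) = Ideal.Quotient.mk n.1.asIdeal D.t := by
  rw [conjAt_mk, D.star_t]

theorem map_dotProduct {S T : Type*} [CommRing S] [CommRing T] {ι : Type*} [Fintype ι]
    (e : S →+* T) (v w : ι → S) : e (v ⬝ᵥ w) = (e ∘ v) ⬝ᵥ (e ∘ w) :=
  e.map_dotProduct v w

variable [Finite (orbit D m)]

/-- The pairing of `(K_𝔫)^e` with `(K_𝔫)^d` that is given by a matrix over `K_ω`. -/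
def pairAt (hreal : IsReal D m) (N : Matrix (Fin f.d) (Fin g.d) (K m)) (n : orbit D m)
    (u : Fin g.d → K n.1) (v : Fin f.d → K n.1) : K n.1 :=
  (twist D m n)⁻¹ * ((N.map (transport D m n)).mulVec u ⬝ᵥ (conjAt D m hreal n ∘ v))

variable {hreal : IsReal D m} {N : Matrix (Fin f.d) (Fin g.d) (K m)}

theorem pairAt_add_right (n : orbit D m) (u : Fin g.d → K n.1) (v w : Fin f.d → K n.1) :
    pairAt hreal N n u (v + w) = pairAt hreal N n u v + pairAt hreal N n u w := by
  have h : conjAt D m hreal n ∘ (v + w) = conjAt D m hreal n ∘ v + conjAt D m hreal n ∘ w :=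
    funext fun i => map_add _ _ _
  rw [pairAt, h, dotProduct_add, mul_add]
  rfl

theorem pairAt_add_left (n : orbit D m) (u w : Fin g.d → K n.1) (v : Fin f.d → K n.1) :
    pairAt hreal N n (u + w) v = pairAt hreal N n u v + pairAt hreal N n w v := by
  rw [pairAt, Matrix.mulVec_add, add_dotProduct, mul_add]
  rfl

theorem pairAt_smul_right (n : orbit D m) (u : Fin g.d → K n.1) (a : K n.1)
    (v : Fin f.d → K n.1) :
    pairAt hreal N n u (a • v) = conjAt D m hreal n a * pairAt hreal N n u v := by
  have h : conjAt D m hreal n ∘ (a • v) = conjAt D m hreal n a • (conjAt D m hreal n ∘ v) :=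
    funext fun i => map_mul _ _ _
  rw [pairAt, h, dotProduct_smul, smul_eq_mul, mul_left_comm]
  rfl

theorem pairAt_smul_left (n : orbit D m) (a : K n.1) (u : Fin g.d → K n.1)
    (v : Fin f.d → K n.1) :
    pairAt hreal N n (a • u) v = a * pairAt hreal N n u v := by
  rw [pairAt, Matrix.mulVec_smul, smul_dotProduct, smul_eq_mul, mul_left_comm]
  rfl

/-- Applying X to both arguments produces the factor σ(t) twice. One of the two is absorbed by the
growth of the twist, the other is the t on the right. At 𝔪(ω) the twist restarts, and the ξ lost
there, together with the two companion matrices, is accounted for by the hypothesis on N. -/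
theorem pairAt_Xcomp (hnb : NoBreaks D m)
    (hN : xi D m • (((companion f).map (conj D m hreal))ᵀ * (N * companion g))
      = N.map (tau D m)) (n : orbit D m) (u : Fin g.d → K n.1) (v : Fin f.d → K n.1) :
    pairAt hreal N (shift D m n) (Xcomp D m g n _ (shift_spec D m n) u)
        (Xcomp D m f n _ (shift_spec D m n) v)
      = upShift D m n (Ideal.Quotient.mk n.1.asIdeal D.t * pairAt hreal N n u v) := by
  have ht := mk_sigma_t_ne_zero D m hnb n
  by_cases hn : n = base D m
  · subst hn
    have key : ∀ (u : Fin g.d → K m) (v : Fin f.d → K m) (a : K m),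
        conj D m hreal a = a → upBase D m a ≠ 0 →
        (upBase D m a)⁻¹ * ((N.map (upBase D m)).mulVec
          (upBase D m ∘ (companion g).mulVec (a • u)) ⬝ᵥ
          (upBase D m ∘ conj D m hreal ∘ (companion f).mulVec (a • v)))
        = upBase D m (a * ((xi D m)⁻¹ *
          ((N.map (tau D m)).mulVec u ⬝ᵥ (conj D m hreal ∘ v)))) := by
      intro u v a ha ha0
      have h1 : conj D m hreal ∘ (a • v) = a • (conj D m hreal ∘ v) :=
        funext fun i => (map_mul _ _ _).trans (by rw [ha]; rfl)
      rw [← map_comp_mulVec, ← map_dotProduct, map_comp_mulVec (conj D m hreal), h1, ← hN,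
        Matrix.mulVec_smul, Matrix.mulVec_smul, Matrix.mulVec_smul, smul_dotProduct,
        dotProduct_smul, Matrix.smul_mulVec, smul_dotProduct, smul_eq_mul, smul_eq_mul,
        smul_eq_mul, inv_mul_cancel_left₀ (xi_ne_zero D m hnb), map_mul, inv_mul_cancel_left₀ ha0,
        Matrix.mulVec_mulVec, Matrix.dotProduct_mulVec, ← Matrix.mulVec_transpose,
        Matrix.mulVec_mulVec]
    have h1 : N.map (transport D m (shift D m (base D m))) = N.map (upBase D m) :=
      Matrix.ext fun i j => transport_shift_base D m _
    have h2 : N.map (transport D m (base D m)) = N.map (tau D m) :=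
      Matrix.ext fun i j => transport_base D m _
    have h3 : ∀ w : Fin f.d → K m, conjAt D m hreal (shift D m (base D m)) ∘ (upBase D m ∘ w)
        = upBase D m ∘ (conj D m hreal ∘ w) :=
      fun w => funext fun i => conjAt_upShift D m hreal (base D m) (w i)
    refine Eq.trans ?_ ((key u v _ (conjAt_mk_t hreal (base D m)) ht).trans ?_)
    · rw [pairAt, twist_shift_base, h1]
      refine congrArg₂ (fun x y => _ * ((N.map (upBase D m)).mulVec x ⬝ᵥ y)) (Xcomp_base u) ?_
      exact (congrArg _ (Xcomp_base v)).trans (h3 _)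
    · rw [pairAt, h2, twist_base]
      rfl
  · have h1 : N.map (transport D m (shift D m n)) = (N.map (transport D m n)).map (upShift D m n) :=
      Matrix.ext fun i j => transport_shift D m hn _
    have h3 : ∀ w : Fin f.d → K n.1, conjAt D m hreal (shift D m n) ∘ (upShift D m n ∘ w)
        = upShift D m n ∘ (conjAt D m hreal n ∘ w) :=
      fun w => funext fun i => conjAt_upShift D m hreal n (w i)
    have h4 : conjAt D m hreal n ∘ (Ideal.Quotient.mk n.1.asIdeal D.t • v)
        = Ideal.Quotient.mk n.1.asIdeal D.t • (conjAt D m hreal n ∘ v) :=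
      funext fun i => (map_mul _ _ _).trans (by rw [conjAt_mk_t]; rfl)
    have h5 : Ideal.Quotient.mk (shift D m n).1.asIdeal (D.sigma D.t)
      = upShift D m n (Ideal.Quotient.mk n.1.asIdeal D.t) := rfl
    rw [pairAt, Xcomp_ne hn, Xcomp_ne hn, h1, twist_shift D m hn, h3, h4, ← map_comp_mulVec,
      ← map_dotProduct, Matrix.mulVec_smul, smul_dotProduct, dotProduct_smul, smul_eq_mul,
      smul_eq_mul, pairAt, h5, map_mul, map_mul, map_mul, map_mul, map_inv₀, mul_inv]
    rw [h5] at ht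
    field_simp

/-- The functional on `V(ω, f)` given by a vector in the component at `𝔫`. -/
def dualOf (hreal : IsReal D m) (N : Matrix (Fin f.d) (Fin g.d) (K m)) (n : orbit D m) :
    (Fin g.d → K n.1) →+ Dual D (V D m f) m where
  toFun u := ⟨(Rom.of D m n).comp (AddMonoidHom.comp
      (AddMonoidHom.mk' (pairAt hreal N n u) (pairAt_add_right n u)) (V.coord n)),
    fun r v => by
      change Rom.of D m n (pairAt hreal N n u (V.coord n (Alg.ofR D r • v)))
        = D.star r • Rom.of D m n (pairAt hreal N n u (V.coord n v))
      rw [V.coord_ofR_smul, pairAt_smul_right, Rom.smul_of, conjAt_mk],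
    Set.toFinite _⟩
  map_zero' := Subtype.ext (AddMonoidHom.ext fun v => by
    change Rom.of D m n (pairAt hreal N n 0 (V.coord n v)) = 0
    rw [pairAt, Matrix.mulVec_zero, zero_dotProduct, mul_zero, map_zero])
  map_add' u w := Subtype.ext (AddMonoidHom.ext fun v => by
    change Rom.of D m n (pairAt hreal N n (u + w) (V.coord n v))
      = Rom.of D m n (pairAt hreal N n u (V.coord n v))
        + Rom.of D m n (pairAt hreal N n w (V.coord n v))
    rw [pairAt_add_left, map_add])

theorem dualOf_apply (n : orbit D m) (u : Fin g.d → K n.1) (v : V D m f) :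
    (dualOf hreal N n u).1 v = Rom.of D m n (pairAt hreal N n u (V.coord n v)) := rfl

/-- The map `V(ω, g) → V(ω, f)^♯` given by a matrix. -/
def V.toDual (hnb : NoBreaks D m)
    (hN : xi D m • (((companion f).map (conj D m hreal))ᵀ * (N * companion g))
      = N.map (tau D m)) : V D m g →ₗ[Alg D] Dual D (V D m f) m :=
  V.lift hnb (dualOf hreal N)
    (fun r n u => Dual.ext fun v => by
      rw [Dual.ofR_smul_apply, dualOf_apply, dualOf_apply, V.coord_ofR_smul, pairAt_smul_right,
        conjAt_mk, D.star_star, pairAt_smul_left])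
    (fun n u => Dual.ext fun v => by
      -- X acts on the dual through Y on the argument. Writing the argument as Xv turns YX into t,
      -- and the claim becomes the invariance of the pairing under X.
      obtain ⟨v, rfl⟩ := exists_X_smul_eq D m f hnb v
      rw [Dual.X_smul_apply, dualOf_apply, dualOf_apply, V.coord_X_smul, ← mul_smul, Alg.Y_mul_X,
        V.coord_ofR_smul, pairAt_smul_right, conjAt_mk_t, pairAt_Xcomp hnb hN, sigmaFwd_of])

theorem V.toDual_of (hnb : NoBreaks D m)
    (hN : xi D m • (((companion f).map (conj D m hreal))ᵀ * (N * companion g))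
      = N.map (tau D m)) (n : orbit D m) (u : Fin g.d → K n.1) :
    V.toDual hnb hN (V.of D m g n u) = dualOf hreal N n u :=
  V.lift_of _ _ _ _ n u

theorem V.toDual_apply_of (hnb : NoBreaks D m)
    (hN : xi D m • (((companion f).map (conj D m hreal))ᵀ * (N * companion g))
      = N.map (tau D m)) (u : V D m g) (n : orbit D m) (v : Fin f.d → K n.1) :
    (V.toDual hnb hN u).1 (V.of D m f n v)
      = Rom.of D m n (pairAt hreal N n (V.coord n u) v) := by
  have h0 : ∀ v, pairAt hreal N n 0 v = 0 := fun v => by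
    rw [pairAt, Matrix.mulVec_zero, zero_dotProduct, mul_zero]
  induction u using V.induction with
  | h0 =>
    rw [map_zero, map_zero, h0, map_zero]
    rfl
  | hof n' u =>
    rw [V.toDual_of, dualOf_apply]
    by_cases h : n' = n
    · subst h
      rw [V.coord_of, V.coord_of]
    · have h1 : pairAt hreal N n' u 0 = 0 := by
        rw [← zero_smul (K n'.1) (0 : Fin f.d → K n'.1), pairAt_smul_right, map_zero, zero_mul]
      rw [V.coord_of_ne h, V.coord_of_ne (Ne.symm h), h0, h1, map_zero, map_zero]
  | hadd a b ha hb =>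
    rw [map_add, map_add, pairAt_add_left, map_add, ← ha, ← hb]
    rfl

/-- On each weight space the pairing is perfect, since the transported N is invertible and the twist
is nonzero. Finiteness of the orbit allows the component preimages to be summed. -/
theorem V.toDual_bijective (hnb : NoBreaks D m)
    (hN : xi D m • (((companion f).map (conj D m hreal))ᵀ * (N * companion g))
      = N.map (tau D m)) {L : Matrix (Fin g.d) (Fin f.d) (K m)} (hNL : N * L = 1)
    (hLN : L * N = 1) : Function.Bijective (V.toDual hnb hN) := by
  have hNL' : ∀ n, N.map (transport D m n) * L.map (transport D m n) = 1 := fun n => by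
    rw [← Matrix.map_mul, hNL, Matrix.map_one _ (map_zero _) (map_one _)]
  have hLN' : ∀ n, L.map (transport D m n) * N.map (transport D m n) = 1 := fun n => by
    rw [← Matrix.map_mul, hLN, Matrix.map_one _ (map_zero _) (map_one _)]
  have hsingle : ∀ (n : orbit D m) (i : Fin f.d),
      conjAt D m hreal n ∘ (Pi.single i 1 : Fin f.d → K n.1) = Pi.single i 1 := by
    intro n i
    funext j
    by_cases h : j = i
    · subst h; simp
    · simp [h]
  constructor
  · refine (injective_iff_map_eq_zero _).mpr fun u hu => V.ext_coord fun n => ?_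
    have h1 : (N.map (transport D m n)).mulVec (V.coord n u) = 0 := by
      funext i
      have h2 := V.toDual_apply_of hnb hN u n (Pi.single i 1)
      rw [hu] at h2
      have h3 : (0 : K n.1) = _ := (map_zero (Rom.coord n)).symm.trans
        ((congrArg (Rom.coord n) h2).trans (Rom.coord_of n _))
      rw [pairAt, hsingle, dotProduct_single_one] at h3
      exact (mul_eq_zero.mp h3.symm).resolve_left (inv_ne_zero (twist_ne_zero D m hnb n))
    rw [← Matrix.one_mulVec (V.coord n u), ← hLN', ← Matrix.mulVec_mulVec, h1,
      Matrix.mulVec_zero, map_zero]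
  · intro φ
    let w : ∀ n : orbit D m, Fin f.d → K n.1 :=
      fun n i => Rom.coord n (φ.1 (V.of D m f n (Pi.single i 1)))
    have hw : ∀ n v, φ.1 (V.of D m f n v) = Rom.of D m n (w n ⬝ᵥ (conjAt D m hreal n ∘ v)) := by
      intro n v
      rw [← Finset.univ_sum_single v, map_sum, map_sum, dotProduct, map_sum]
      refine Finset.sum_congr rfl fun i _ => ?_
      obtain ⟨r, hr⟩ := Ideal.Quotient.mk_surjective (v i)
      have h1 : (Pi.single i (v i) : Fin f.d → K n.1)
          = Ideal.Quotient.mk n.1.asIdeal r • Pi.single i 1 := by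
        rw [hr, ← Pi.single_smul, smul_eq_mul, mul_one]
      -- A functional maps the weight space at 𝔫 into K_𝔫: its values there are killed by 𝔫* = 𝔫,
      -- the orbit being real.
      have h2 : Rom.of D m n (w n i) = φ.1 (V.of D m f n (Pi.single i 1)) := by
        refine Rom.eq_of_coord fun r hr => ?_
        rw [← D.star_star r, ← φ.2.1, V.of_mem n _ _ (star_mem D m hreal hr), map_zero]
      rw [h1, ← ofR_smul_of, φ.2.1, ← h2, Rom.smul_of, Function.comp_apply, Finset.univ_sum_single,
        ← hr, conjAt_mk, mul_comm]
    have := Fintype.ofFinite (orbit D m)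
    -- The factors `L` and `twist` cancel the matrix N and the inverse twist in the pairing, leaving
    -- the coefficients w of the given functional.
    refine ⟨∑ n, V.of D m g n ((L.map (transport D m n)).mulVec (twist D m n • w n)),
      Dual.ext fun v => ?_⟩
    induction v using V.induction with
    | h0 => rw [map_zero, map_zero]
    | hof n v =>
      have h1 : V.coord n (∑ n, V.of D m g n ((L.map (transport D m n)).mulVec
          (twist D m n • w n))) = (L.map (transport D m n)).mulVec (twist D m n • w n) := by
        rw [map_sum, Finset.sum_eq_single n]
        · rw [V.coord_of]
        · exact fun b _ hb => V.coord_of_ne hb _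
        · exact fun h => absurd (Finset.mem_univ n) h
      rw [V.toDual_apply_of, hw, h1, pairAt, Matrix.mulVec_mulVec, hNL', Matrix.one_mulVec,
        smul_dotProduct, smul_eq_mul, inv_mul_cancel_left₀ (twist_ne_zero D m hnb n)]
    | hadd a b ha hb => rw [map_add, map_add, ha, hb]

variable (hreal) (f) in
theorem nonempty_dual_equiv (hnb : NoBreaks D m) :
    Nonempty (Dual D (V D m f) m ≃ₗ[Alg D] V D m (sharp D m hreal hnb f)) := by
  obtain ⟨N, hLN, hNL⟩ := exists_sharpMat_inv D m hreal hnb f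
  exact ⟨(LinearEquiv.ofBijective _
    (V.toDual_bijective hnb (conj_sharpMat_inv hNL hLN) hNL hLN)).symm⟩

end dualModule

/-! ### V(ω, f) as a weight module with finite-dimensional weight spaces. -/

section weight

variable {R : Type u} [CommRing R] (D : Datum R) (m : MaximalSpectrum R) (f : Coeffs (K m))

theorem eq_zero_of_mem_weightSpace {n : MaximalSpectrum R} (hn : n ∉ orbit D m) {v : V D m f}
    (hv : v ∈ weightSpace D (V D m f) n) : v = 0 := by
  refine V.ext_coord fun n' => ?_
  have h : n ≠ n'.1 := by
    rintro rfl
    exact hn n'.2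
  rw [V.coord_eq_zero h hv, map_zero]

theorem support_V_subset : support D (V D m f) ⊆ orbit D m := by
  intro n hn
  by_contra h
  exact hn ((AddSubgroup.eq_bot_iff_forall _).mpr fun v hv =>
    eq_zero_of_mem_weightSpace D m f h hv)

theorem isWeightModule_V : IsWeightModule D (V D m f) := by
  classical
  constructor
  · refine (injective_iff_map_eq_zero _).mpr fun x hx => DFinsupp.ext fun n => ?_
    by_cases hn : n ∈ orbit D m
    · refine Subtype.ext (V.ext_coord fun n' => ?_)
      by_cases h : n = n'.1
      · have h1 := congrArg (V.coord n') hx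
        rw [DirectSum.coeAddMonoidHom_eq_dfinsuppSum, DFinsupp.sum, map_sum,
          Finset.sum_eq_single n] at h1
        · exact h1
        · exact fun b _ hb => V.coord_eq_zero (fun hc => hb (hc.trans h.symm)) (x b).2
        · intro h2
          rw [DFinsupp.notMem_support_iff.mp h2]
          exact map_zero _
      · rw [V.coord_eq_zero h (x n).2]
        exact (map_zero _).symm
    · exact Subtype.ext (eq_zero_of_mem_weightSpace D m f hn (x n).2)
  · intro v
    induction v using V.induction with
    | h0 => exact ⟨0, map_zero _⟩
    | hof n v =>
      exact ⟨DirectSum.of (fun n => weightSpace D (V D m f) n) n.1 ⟨V.of D m f n v, V.of_mem n v⟩,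
        DirectSum.coeAddMonoidHom_of _ _ _⟩
    | hadd a b ha hb =>
      obtain ⟨x, hx⟩ := ha
      obtain ⟨y, hy⟩ := hb
      exact ⟨x + y, by rw [map_add, hx, hy]⟩

variable {D m f}

/-- A homomorphism acts weight space by weight space, and these are vector spaces of equal finite
dimension. -/
theorem V.surjective_of_injective {g : Coeffs (K m)} (hd : f.d = g.d)
    (φ : V D m f →ₗ[Alg D] V D m g) (hφ : Function.Injective φ) : Function.Surjective φ := by
  intro v
  induction v using V.induction with
  | h0 => exact ⟨0, map_zero φ⟩
  | hof n v =>
    have h1 : Function.Injective (V.mapAt φ n) := by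
      intro a b h
      have h2 := congrArg (V.of D m g n) h
      rw [V.of_mapAt, V.of_mapAt] at h2
      exact V.of_injective n (hφ h2)
    obtain ⟨w, hw⟩ := (LinearMap.injective_iff_surjective_of_finrank_eq_finrank
      (by rw [Module.finrank_fin_fun, Module.finrank_fin_fun, hd])).mp h1 v
    exact ⟨V.of D m f n w, by rw [← V.of_mapAt, hw]⟩
  | hadd a b ha hb =>
    obtain ⟨x, hx⟩ := ha
    obtain ⟨y, hy⟩ := hb
    exact ⟨x + y, by rw [map_add, hx, hy]⟩

end weight

/-! ### Admissible forms as homomorphisms to the dual. -/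

section forms

variable {R : Type u} [CommRing R] {D : Datum R} {m : MaximalSpectrum R}
  {W : Type v} [AddCommGroup W] [Module (Alg D) W]

theorem Alg.adj_ofR (r : R) : Alg.adj D (Alg.ofR D r) = Alg.ofR D (D.star r) :=
  congrArg MulOpposite.unop (Alg.lift_ofR D _ _ _ _ _ _ _ r)

theorem Alg.adj_X : Alg.adj D (Alg.X D) = Alg.Y D :=
  congrArg MulOpposite.unop (Alg.lift_X D _ _ _ _ _ _ _)

theorem Alg.adj_Y : Alg.adj D (Alg.Y D) = Alg.X D :=
  congrArg MulOpposite.unop (Alg.lift_Y D _ _ _ _ _ _ _)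

theorem Alg.adj_zero : Alg.adj D 0 = 0 :=
  congrArg MulOpposite.unop (map_zero (Alg.starHom D))

theorem Alg.adj_add (a b : Alg D) : Alg.adj D (a + b) = Alg.adj D a + Alg.adj D b :=
  congrArg MulOpposite.unop (map_add (Alg.starHom D) a b)

theorem Alg.adj_mul (a b : Alg D) : Alg.adj D (a * b) = Alg.adj D b * Alg.adj D a :=
  congrArg MulOpposite.unop (map_mul (Alg.starHom D) a b)

theorem sigmaOm_zpow_zero (n : ℤ) : (sigmaOm D m ^ n) 0 = 0 := by
  induction n with
  | zero => rfl
  | succ n ih =>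
    rw [zpow_add_one, Equiv.Perm.mul_apply]
    exact (congrArg _ (map_zero (sigmaFwd D m))).trans ih
  | pred n ih =>
    rw [zpow_sub_one, Equiv.Perm.mul_apply]
    exact (congrArg _ (map_zero (sigmaBwd D m))).trans ih

theorem sigmaOm_zpow_add (n : ℤ) (a b : Rom D m) :
    (sigmaOm D m ^ n) (a + b) = (sigmaOm D m ^ n) a + (sigmaOm D m ^ n) b := by
  induction n generalizing a b with
  | zero => rfl
  | succ n ih =>
    rw [zpow_add_one, Equiv.Perm.mul_apply, Equiv.Perm.mul_apply, Equiv.Perm.mul_apply, ← ih]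
    exact congrArg _ (map_add (sigmaFwd D m) a b)
  | pred n ih =>
    rw [zpow_sub_one, Equiv.Perm.mul_apply, Equiv.Perm.mul_apply, Equiv.Perm.mul_apply, ← ih]
    exact congrArg _ (map_add (sigmaBwd D m) a b)

/-- The form associated with a homomorphism to the dual. -/
def formOf (φ : W →ₗ[Alg D] Dual D W m) : W →+ W →+ Rom D m where
  toFun v := (φ v).1
  map_zero' := by rw [map_zero]; rfl
  map_add' v w := by rw [map_add]; rfl

theorem isAdmissible_formOf (φ : W →ₗ[Alg D] Dual D W m) : IsAdmissible D m (formOf φ) where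
  smul_left r v w := by
    change (φ (Alg.ofR D r • v)).1 w = r • (φ v).1 w
    rw [map_smul, Dual.ofR_smul_apply, (φ v).2.1, D.star_star]
  adjoint n a ha := by
    change ∀ v w, (φ (a • v)).1 w = (sigmaOm D m ^ n) ((φ v).1 (Alg.adj D a • w))
    induction ha with
    | ofR r =>
      intro v w
      rw [map_smul, Dual.ofR_smul_apply, Alg.adj_ofR]
      rfl
    | X =>
      intro v w
      rw [map_smul, Dual.X_smul_apply, Alg.adj_X, zpow_one]
      rfl
    | Y =>
      intro v w
      rw [map_smul, Dual.Y_smul_apply, Alg.adj_Y, zpow_neg_one]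
      rfl
    | zero n =>
      intro v w
      rw [zero_smul, map_zero, Alg.adj_zero, zero_smul, map_zero, sigmaOm_zpow_zero]
      rfl
    | add _ _ iha ihb =>
      intro v w
      rw [add_smul, map_add, Alg.adj_add, add_smul, map_add, sigmaOm_zpow_add, ← iha, ← ihb]
      rfl
    | mul _ _ iha ihb =>
      intro v w
      rw [mul_smul, iha, ihb, Alg.adj_mul, mul_smul, zpow_add, Equiv.Perm.mul_apply]

/-- The homomorphism to the dual associated with an admissible form. -/
def homOfForm [Finite (orbit D m)] {F : W →+ W →+ Rom D m} (hF : IsAdmissible D m F) :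
    W →ₗ[Alg D] Dual D W m :=
  let φ : W →+ Dual D W m := AddMonoidHom.mk' (fun v => ⟨F v, fun r w => by
      -- The adjoint rule in degree 0 for r* turns linearity in the first argument into
      -- semilinearity in the second, as the dual demands.
      have h := hF.adjoint 0 _ (IsHomog.ofR (D.star r)) v w
      rw [Alg.adj_ofR, D.star_star, zpow_zero, hF.smul_left] at h
      exact h.symm, Set.toFinite _⟩) fun v w => Subtype.ext (map_add F v w)
  { φ with
    map_smul' := Alg.map_smul_of_gen D φ
      (fun r v => Dual.ext fun w => by
        rw [Dual.ofR_smul_apply]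
        exact (hF.adjoint 0 _ (IsHomog.ofR r) v w).trans (by rw [Alg.adj_ofR]; rfl))
      (fun v => Dual.ext fun w => by
        rw [Dual.X_smul_apply]
        exact (hF.adjoint 1 _ IsHomog.X v w).trans (by rw [Alg.adj_X]; rfl))
      (fun v => Dual.ext fun w => by
        rw [Dual.Y_smul_apply]
        exact (hF.adjoint (-1) _ IsHomog.Y v w).trans (by rw [Alg.adj_Y]; rfl)) }

theorem homOfForm_apply [Finite (orbit D m)] {F : W →+ W →+ Rom D m} (hF : IsAdmissible D m F)
    (v w : W) : (homOfForm hF v).1 w = F v w := rfl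

/-- Non-degeneracy in the first argument is injectivity of V → V♯, which forces bijectivity because
V♯ ≅ V(ω, f♯) has the same d. Conversely, surjectivity gives non-degeneracy in the second argument,
because V♯ separates the points of V. -/
theorem isPseudoUnitarizable_V_iff [Finite (orbit D m)] (hreal : IsReal D m)
    (hnb : NoBreaks D m) (f : Coeffs (K m)) : IsPseudoUnitarizable D (V D m f) m ↔
      Nonempty (V D m f ≃ₗ[Alg D] Dual D (V D m f) m) := by
  obtain ⟨e⟩ := nonempty_dual_equiv f hreal hnb
  constructor
  · rintro ⟨-, -, F, hF, hnd⟩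
    have hinj : Function.Injective (homOfForm hF) := by
      refine (injective_iff_map_eq_zero _).mpr fun v hv => ?_
      by_contra h
      obtain ⟨-, w, -, hw⟩ := hnd v h
      rw [← homOfForm_apply hF, hv] at hw
      exact hw rfl
    have hd : f.d = (sharp D m hreal hnb f).d := rfl
    have hsurj := V.surjective_of_injective hd (e.toLinearMap ∘ₗ homOfForm hF)
      (e.injective.comp hinj)
    refine ⟨LinearEquiv.ofBijective (homOfForm hF) ⟨hinj, fun φ => ?_⟩⟩
    obtain ⟨v, hv⟩ := hsurj (e φ)
    exact ⟨v, e.injective hv⟩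
  · rintro ⟨φ⟩
    refine ⟨isWeightModule_V D m f, support_V_subset D m f, formOf φ.toLinearMap,
      isAdmissible_formOf _, fun v hv => ?_⟩
    have hleft : ∃ w, (φ v).1 w ≠ 0 := by
      by_contra! h
      exact hv (φ.map_eq_zero_iff.mp (Dual.ext h))
    have hright : ∃ ψ : Dual D (V D m f) m, ψ.1 v ≠ 0 := by
      obtain ⟨n, hn⟩ : ∃ n, V.coord n v ≠ 0 := by
        by_contra! h
        exact hv (V.ext_coord fun n => (h n).trans (map_zero _).symm)
      obtain ⟨i, hi⟩ := Function.ne_iff.mp hn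
      -- A single functional detecting the i-th coordinate at 𝔫 is enough. The identity matrix
      -- serves here, since no compatibility with X is asked of an individual functional.
      refine ⟨dualOf (g := f) hreal 1 n (Pi.single i 1), fun h => ?_⟩
      rw [dualOf_apply] at h
      have h1 := (Rom.coord_of n _).symm.trans ((congrArg (Rom.coord n) h).trans (map_zero _))
      rw [pairAt, Matrix.map_one _ (map_zero _) (map_one _), Matrix.one_mulVec,
        single_one_dotProduct] at h1
      exact hi ((map_eq_zero _).mp
        ((mul_eq_zero.mp h1).resolve_left (inv_ne_zero (twist_ne_zero D m hnb n))))
    obtain ⟨w₂, hw₂⟩ := hleft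
    obtain ⟨ψ, hψ⟩ := hright
    obtain ⟨w₁, rfl⟩ := φ.surjective ψ
    exact ⟨w₁, w₂, hψ, hw₂⟩

end forms

end GenWeyl

end

theorem theorem5p6 {R : Type*} [CommRing R] (D : GenWeyl.Datum R) (m : MaximalSpectrum R)
    (hfin : (GenWeyl.orbit D m).Finite) (hreal : GenWeyl.IsReal D m)
    (hnb : GenWeyl.NoBreaks D m) (f : GenWeyl.Coeffs (GenWeyl.K m))
    (hf : GenWeyl.IsIndecomposable (GenWeyl.poly D m f)) :
    GenWeyl.IsIndecomposable (GenWeyl.poly D m (GenWeyl.sharp D m hreal hnb f)) ∧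
    Nonempty (GenWeyl.Dual D (GenWeyl.V D m f) m ≃ₗ[GenWeyl.Alg D]
      GenWeyl.V D m (GenWeyl.sharp D m hreal hnb f)) ∧
    (GenWeyl.IsPseudoUnitarizable D (GenWeyl.V D m f) m ↔
      GenWeyl.IsSimilar (GenWeyl.poly D m f)
        (GenWeyl.poly D m (GenWeyl.sharp D m hreal hnb f))) := by
  have : Finite (GenWeyl.orbit D m) := hfin
  obtain ⟨e⟩ := GenWeyl.nonempty_dual_equiv f hreal hnb
  refine ⟨GenWeyl.isIndecomposable_sharp D m hreal hnb f hf, ⟨e⟩, ?_⟩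
  -- Both sides now assert an isomorphism from V(ω, f), to V(ω, f)♯ and to V(ω, f♯) respectively;
  -- `e` identifies the two targets.
  rw [GenWeyl.isPseudoUnitarizable_V_iff hreal hnb, ← GenWeyl.nonempty_V_equiv_iff hnb]
  exact ⟨fun ⟨φ⟩ => ⟨φ.trans e⟩, fun ⟨φ⟩ => ⟨φ.trans e.symm⟩⟩
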